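/- Let $(\xi_i)_{i\ge 1}$ be independent identically distributed real random variables with $E\xi_i=0$ and $\operatorname{Var}\xi_i=\sigma^2$, where $\sigma\in(0,\infty)$. Let $F$ be their distribution function, $f(t)=Ee^{it\xi_1}$ their characteristic function, $\Phi$ the standard normal distribution function, and $$\Phi_n(x)=P\Bigl\{\frac{\xi_1+\cdots+\xi_n}{\sigma\sqrt n}<x\Bigr\},\qquad H(x)=F(x\sigma)-\Phi(x).$$ Write $dH$ for the signed measure generated by $H$ and $|dH|$ for its total variation measure. Let $m\ge 3$ be an integer and suppose that (i) $A=\int_{\mathbb R}|f(t)|\,dt<\infty$; (ii) the pseudomoments $\mu_k=\int_{\mathbb R}x^k\,dH(x)$, $k=3,\dots,m$, exist (i.e. $\int_{\mathbb R}|x|^k\,|dH(x)|<\infty$) and are equal to $0$. For $n\ge 1$ put $$\nu_n^{(1)}(m)=\int_{|x|\le\sigma\sqrt n}|x|^{m+1}\,|dH(x)|,\qquad \nu_n^{(2)}(m)=\int_{|x|>\sigma\sqrt n}|x|^{m}\,|dH(x)|,\qquad \nu_n(m)=\max\{\nu_n^{(1)}(m),\nu_n^{(2)}(m)\},$$ and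 let $$C^{(1)}_m=\frac{12^{\frac{m+1}{2}}\,\Gamma\bigl(\frac{m+1}{2}\bigr)}{\pi\,(m+1)!},\qquad C^{(2)}_m=2C^{(1)}_{m-1},\qquad b=\exp\Bigl\{-\frac{\pi^2}{24A^2\sigma^2(2+\pi)^2}\Bigr\}.$$ Then $b<1$, and for every $n\ge 2$ such that $\nu_n(m)<\frac12e^{-3/2}$, $$\sup_{x\in\mathbb R}|\Phi_n(x)-\Phi(x)|\le 2C^{(1)}_m\frac{\nu_n^{(1)}(m)}{n^{\frac{m-1}{2}}}+2C^{(2)}_m\frac{\nu_n^{(2)}(m)}{n^{\frac{m-2}{2}}}+\frac{\sigma A}{\pi}\,b^{\,n-1}+\nu_n(m)\,\frac{4e^{3/2}}{\pi}\,\frac{e^{-n/2}}{n}.$$ -/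

import Mathlib

open MeasureTheory ProbabilityTheory

noncomputable section

namespace Pseudomoments

/-- The standard normal distribution function `Φ`. -/
def stdNormalCDF (x : ℝ) : ℝ := cdf (gaussianReal 0 1) x

/-- The signed measure `dH`, where `H x = F (x * σ) - Φ x` and `F` is the distribution function of
the law `L`: the image of `L` under `x ↦ x / σ` has distribution function `x ↦ F (x * σ)`. -/
def pseudoMeasure (L : Measure ℝ) [IsFiniteMeasure L] (σ : ℝ) : SignedMeasure ℝ :=
  (L.map (fun x => x / σ)).toSignedMeasure - (gaussianReal 0 1).toSignedMeasure

/-- `dH` gives the half line `(-∞, x]` the mass `H x = F (x * σ) - Φ x`. -/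
theorem pseudoMeasure_Iic (L : Measure ℝ) [IsProbabilityMeasure L] {σ : ℝ} (hσ : 0 < σ) (x : ℝ) :
    pseudoMeasure L σ (Set.Iic x) = cdf L (x * σ) - stdNormalCDF x := by
  have hpre : (fun y : ℝ => y / σ) ⁻¹' Set.Iic x = Set.Iic (x * σ) := by
    ext y
    simp [div_le_iff₀ hσ]
  rw [pseudoMeasure, Measure.toSignedMeasure_sub_apply measurableSet_Iic, stdNormalCDF,
    cdf_eq_real, cdf_eq_real, map_measureReal_apply (by fun_prop) measurableSet_Iic, hpre]

/-- The pseudomoment `μ_k = ∫ x ^ k dH(x)`. -/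
def pseudomoment (L : Measure ℝ) [IsFiniteMeasure L] (σ : ℝ) (k : ℕ) : ℝ :=
  (pseudoMeasure L σ).integral (fun x : ℝ => x ^ k) (ContinuousLinearMap.lsmul ℝ ℝ).flip

/-- `ν_n^{(1)}(m) = ∫_{|x| ≤ σ √n} |x| ^ (m + 1) |dH(x)|`. -/
def nu1 (L : Measure ℝ) [IsFiniteMeasure L] (σ : ℝ) (m n : ℕ) : ℝ :=
  ∫ x in {x : ℝ | |x| ≤ σ * √(n : ℝ)}, |x| ^ (m + 1) ∂(pseudoMeasure L σ).variation

/-- `ν_n^{(2)}(m) = ∫_{|x| > σ √n} |x| ^ m |dH(x)|`. -/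
def nu2 (L : Measure ℝ) [IsFiniteMeasure L] (σ : ℝ) (m n : ℕ) : ℝ :=
  ∫ x in {x : ℝ | σ * √(n : ℝ) < |x|}, |x| ^ m ∂(pseudoMeasure L σ).variation

/-- `ν_n(m) = max {ν_n^{(1)}(m), ν_n^{(2)}(m)}`. -/
def nu (L : Measure ℝ) [IsFiniteMeasure L] (σ : ℝ) (m n : ℕ) : ℝ :=
  max (nu1 L σ m n) (nu2 L σ m n)

/-- `C^{(1)}_m = 12 ^ ((m + 1) / 2) Γ((m + 1) / 2) / (π (m + 1)!)`. -/
def C1 (m : ℕ) : ℝ :=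
  (12 : ℝ) ^ (((m : ℝ) + 1) / 2) * Real.Gamma (((m : ℝ) + 1) / 2) /
    (Real.pi * ((m + 1).factorial : ℝ))

/-- `C^{(2)}_m = 2 C^{(1)}_{m-1}` (used for `m ≥ 3` only). -/
def C2 (m : ℕ) : ℝ := 2 * C1 (m - 1)

/-- `A = ∫ |f(t)| dt`, where `f` is the characteristic function of the law `L`. -/
def charFunL1 (L : Measure ℝ) : ℝ := ∫ t : ℝ, ‖charFun L t‖

/-- `b = exp (-π² / (24 A² σ² (2 + π)²))`. -/
def bConst (A σ : ℝ) : ℝ :=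
  Real.exp (-(Real.pi ^ 2 / (24 * A ^ 2 * σ ^ 2 * (2 + Real.pi) ^ 2)))

/-- The distribution function `Φ_n(x) = P (S_n < x)` of the normalized sum
`S_n = (σ √n)⁻¹ (ξ_1 + ⋯ + ξ_n)`; the sequence is indexed from `0`. -/
def sumCDF {Ω : Type*} [MeasurableSpace Ω] (P : Measure Ω) (ξ : ℕ → Ω → ℝ) (σ : ℝ) (n : ℕ)
    (x : ℝ) : ℝ :=
  P.real {ω | (σ * √(n : ℝ))⁻¹ * ∑ i ∈ Finset.range n, ξ i ω < x}

end Pseudomoments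

end

/-! Let `g` be the characteristic function of `ξ / σ` and `φ(t) = exp (-t² / 2)`. Mean zero, unit
variance and vanishing pseudomoments make all moments of orders `0, …, m` Gaussian. The Taylor
polynomials therefore cancel in `g - φ`, leaving a Taylor remainder integrated against `|dH|` and
split at `σ √n` (`norm_charFun_sub_charFun_le`).

Fourier inversion, made rigorous by Gaussian mollification, bounds the distance of the distribution
functions by `1/π` times the integral of any majorant of `|g(s)^n - φ(s)^n| / |s|`
(`abs_measureReal_Iio_sub_le`). The majorant comes from two regimes separated by `T ≥ 1` with `exp
(-T² / 2) = 3ρ`, where `ρ` is slightly above `ν_n(m)`. For `|s| ≤ T` one has `|g(s)| ≤ exp (-s² /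
6)` (`norm_charFun_le_exp_neg_sq_div_six`), so the difference of `n`-th powers is at most `n |g - φ|
exp (-n s² / 12)`, whose Gamma integrals produce `C1` and `C2`. For `|s| > T` the two powers are
bounded separately: `|g|^n ≤ b^(n-1) |g|` gives the term with `A`, and the Gaussian tail gives the
last term.

The bound `|g| ≤ b` off `(-1, 1)` (`norm_charFun_le_bConst`) holds because `|g(t)|` close to `1`
forces `|g|` to be large near `0, t, 2t, …`, which the finite `L¹` norm of `g` permits only for a
limited number of multiples. -/

/-! ### Taylor remainders of the imaginary exponential -/

/-- The `n`-th Taylor remainder of `u ↦ exp (z u)` at `0`. -/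
noncomputable def expRemainder (z : ℂ) (n : ℕ) (u : ℝ) : ℂ :=
  Complex.exp (u * z) - ∑ k ∈ Finset.range n, (u * z) ^ k / (k.factorial : ℂ)

theorem expRemainder_succ (z : ℂ) (n : ℕ) (u : ℝ) :
    expRemainder z (n + 1) u = expRemainder z n u - (u * z) ^ n / (n.factorial : ℂ) := by
  simp only [expRemainder, Finset.sum_range_succ]
  ring

theorem continuous_expRemainder (z : ℂ) (n : ℕ) : Continuous (expRemainder z n) := by
  unfold expRemainder
  fun_prop

theorem hasDerivAt_expRemainder_succ (z : ℂ) (n : ℕ) (u : ℝ) :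
    HasDerivAt (expRemainder z (n + 1)) (z * expRemainder z n u) u := by
  have hlin : HasDerivAt (fun v : ℝ => (v : ℂ) * z) z u := by
    simpa using (Complex.ofRealCLM.hasDerivAt (x := u)).mul_const z
  induction n with
  | zero =>
    have h := hlin.cexp.sub_const 1
    refine (h.congr_deriv ?_).congr_of_eventuallyEq (.of_forall fun v => ?_)
    · simp [expRemainder, mul_comm]
    · simp [expRemainder]
  | succ n ih =>
    have h := ih.sub ((hlin.pow (n + 1)).div_const ((n + 1).factorial : ℂ))
    refine (h.congr_deriv ?_).congr_of_eventuallyEq (.of_forall fun v => ?_)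
    · rw [expRemainder_succ z n u, Nat.factorial_succ]
      have h1 : (n.factorial : ℂ) ≠ 0 := by exact_mod_cast n.factorial_ne_zero
      have h2 : (n : ℂ) + 1 ≠ 0 := by exact_mod_cast n.succ_ne_zero
      push_cast
      field_simp
    · rw [expRemainder_succ z (n + 1) v]
      simp

/-- Each remainder vanishes at `0` and has derivative `z` times the previous one, so the bound
integrates up by induction. A general imaginary `z` is allowed so that negative `u` can be handled
by replacing `I` with `-I`. -/
theorem norm_expRemainder_le_of_nonneg {z : ℂ} (hz : z.re = 0) (hz1 : ‖z‖ ≤ 1) (n : ℕ) {u : ℝ}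
    (hu : 0 ≤ u) : ‖expRemainder z n u‖ ≤ u ^ n / n.factorial := by
  induction n generalizing u with
  | zero => simp [expRemainder, Complex.norm_exp, hz]
  | succ n ih =>
    refine image_norm_le_of_norm_deriv_right_le_deriv_boundary (a := 0) (b := u)
      (B := fun v => v ^ (n + 1) / (n + 1).factorial) (B' := fun v => v ^ n / n.factorial)
      (continuous_expRemainder z (n + 1)).continuousOn
      (fun v _ => (hasDerivAt_expRemainder_succ z n v).hasDerivWithinAt) ?_ (fun v => ?_)
      (fun v hv => ?_) ⟨hu, le_rfl⟩
    · simp [expRemainder, Finset.sum_range_succ']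
    · refine ((hasDerivAt_pow (n + 1) v).div_const _).congr_deriv ?_
      have h1 : (n.factorial : ℝ) ≠ 0 := by exact_mod_cast n.factorial_ne_zero
      rw [Nat.factorial_succ]
      push_cast
      field_simp
    · rw [norm_mul]
      exact (mul_le_of_le_one_left (norm_nonneg _) hz1).trans (ih hv.1)

theorem norm_expRemainder_I_le (n : ℕ) (u : ℝ) :
    ‖expRemainder Complex.I n u‖ ≤ |u| ^ n / n.factorial := by
  rcases le_total 0 u with hu | hu
  · rw [abs_of_nonneg hu]
    exact norm_expRemainder_le_of_nonneg (by simp) (by simp) n hu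
  · have h : expRemainder Complex.I n u = expRemainder (-Complex.I) n (-u) := by
      simp [expRemainder]
    rw [abs_of_nonpos hu, h]
    exact norm_expRemainder_le_of_nonneg (by simp) (by simp) n (neg_nonneg.2 hu)

/-- Gives up one power of `u`: the last Taylor term and the shorter remainder obey the same bound.
This serves large `|x|`, where only moments of order `m` are available. -/
theorem norm_expRemainder_I_succ_le (n : ℕ) (u : ℝ) :
    ‖expRemainder Complex.I (n + 1) u‖ ≤ 2 * (|u| ^ n / n.factorial) := by
  rw [expRemainder_succ]
  refine (norm_sub_le _ _).trans ?_
  have h : ‖((u : ℂ) * Complex.I) ^ n / (n.factorial : ℂ)‖ = |u| ^ n / n.factorial := by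
    simp
  linarith [norm_expRemainder_I_le n u]

/-! ### Characteristic functions of laws with matching moments -/

theorem integrable_ofReal_mul_I_pow_div (μ : Measure ℝ) {m : ℕ} (k : ℕ) (hk : k ≤ m) (t : ℝ)
    (hμ : ∀ k ≤ m, Integrable (fun x : ℝ => x ^ k) μ) :
    Integrable (fun x : ℝ => (((t * x : ℝ) : ℂ) * Complex.I) ^ k / (k.factorial : ℂ)) μ := by
  have h := ((hμ k hk).ofReal (𝕜 := ℂ)).const_mul ((t * Complex.I) ^ k / (k.factorial : ℂ))
  refine h.congr (.of_forall fun x => ?_)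
  simp only [Complex.ofReal_mul, mul_pow, RCLike.ofReal_pow, Complex.coe_algebraMap]
  ring

section Moments

variable (μ ν : Measure ℝ) [IsFiniteMeasure μ] [IsFiniteMeasure ν]

theorem norm_integral_sub_integral_le_variation {f : ℝ → ℂ} (hμ : Integrable f μ)
    (hν : Integrable f ν) :
    ‖∫ x, f x ∂μ - ∫ x, f x ∂ν‖ ≤
      ∫ x, ‖f x‖ ∂(μ.toSignedMeasure - ν.toSignedMeasure).variation := by
  have h1 : μ.toSignedMeasure.Integrable f := by simpa [VectorMeasure.Integrable] using hμ
  have h2 : ν.toSignedMeasure.Integrable f := by simpa [VectorMeasure.Integrable] using hν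
  have h := VectorMeasure.norm_integral_le_integral_norm (f := f)
    (μ := μ.toSignedMeasure - ν.toSignedMeasure)
    (B := (ContinuousLinearMap.lsmul ℝ ℝ (E := ℂ)).flip)
  rw [VectorMeasure.integral_sub_vectorMeasure h1 h2, VectorMeasure.integral_toSignedMeasure,
    VectorMeasure.integral_toSignedMeasure] at h
  refine h.trans (mul_le_of_le_one_left (by positivity) ?_)
  rw [ContinuousLinearMap.opNorm_flip]
  exact ContinuousLinearMap.opNorm_lsmul_le

theorem isFiniteMeasure_variation_sub :
    IsFiniteMeasure (μ.toSignedMeasure - ν.toSignedMeasure).variation := by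
  refine isFiniteMeasure_of_le (μ + ν) ?_
  refine VectorMeasure.variation_sub_le.trans ?_
  simp

theorem integrable_variation_sub {f : ℝ → ℝ} (hμ : Integrable f μ) (hν : Integrable f ν) :
    Integrable f (μ.toSignedMeasure - ν.toSignedMeasure).variation := by
  refine (integrable_add_measure.2 ⟨hμ, hν⟩).mono_measure ?_
  refine VectorMeasure.variation_sub_le.trans ?_
  simp

/-- Lets integrability against `|dH|` pass to the law itself, since the Gaussian has all moments. -/
theorem le_variation_sub_add :
    μ ≤ (μ.toSignedMeasure - ν.toSignedMeasure).variation + ν := by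
  have h : μ.toSignedMeasure.variation ≤ (μ.toSignedMeasure - ν.toSignedMeasure).variation
      + ν.toSignedMeasure.variation := by
    conv_lhs => rw [← sub_add_cancel μ.toSignedMeasure ν.toSignedMeasure]
    exact VectorMeasure.variation_add_le
  simpa using h

theorem integrable_exp_mul_I (t : ℝ) :
    Integrable (fun x : ℝ => Complex.exp (((t * x : ℝ) : ℂ) * Complex.I)) μ := by
  refine Integrable.of_bound (C := 1) (by fun_prop) (.of_forall fun x => ?_)
  rw [Complex.norm_exp_ofReal_mul_I]

theorem integrable_expRemainder {m : ℕ} (t : ℝ)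
    (hμ : ∀ k ≤ m, Integrable (fun x : ℝ => x ^ k) μ) :
    Integrable (fun x : ℝ => expRemainder Complex.I (m + 1) (t * x)) μ := by
  refine (integrable_exp_mul_I μ t).sub (integrable_finsetSum _ fun k hk => ?_)
  exact integrable_ofReal_mul_I_pow_div μ k (Nat.lt_succ_iff.1 (Finset.mem_range.1 hk)) t hμ

theorem integral_expRemainder {m : ℕ} (t : ℝ)
    (hμ : ∀ k ≤ m, Integrable (fun x : ℝ => x ^ k) μ) :
    ∫ x, expRemainder Complex.I (m + 1) (t * x) ∂μ =
      charFun μ t - ∑ k ∈ Finset.range (m + 1),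
        (t * Complex.I) ^ k / (k.factorial : ℂ) * ((∫ x, x ^ k ∂μ : ℝ) : ℂ) := by
  have hk : ∀ k ∈ Finset.range (m + 1), Integrable
      (fun x : ℝ => (((t * x : ℝ) : ℂ) * Complex.I) ^ k / (k.factorial : ℂ)) μ := fun k hk =>
    integrable_ofReal_mul_I_pow_div μ k (Nat.lt_succ_iff.1 (Finset.mem_range.1 hk)) t hμ
  simp only [expRemainder]
  rw [integral_sub (integrable_exp_mul_I μ t) (integrable_finsetSum _ hk),
    integral_finsetSum _ hk, charFun_apply_real]
  congr 1
  · simp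
  · refine Finset.sum_congr rfl fun k _ => ?_
    rw [← integral_complex_ofReal, ← integral_const_mul]
    congr 1 with x
    push_cast
    simp only [mul_pow]
    ring

variable {μ ν}

/-- If the moments of orders `0, …, m` of two laws agree, the difference of their characteristic
functions is controlled by truncated absolute pseudomoments. -/
theorem norm_charFun_sub_charFun_le {m : ℕ}
    (hμ : ∀ k ≤ m, Integrable (fun x : ℝ => x ^ k) μ)
    (hν : ∀ k ≤ m, Integrable (fun x : ℝ => x ^ k) ν)
    (hmom : ∀ k ≤ m, ∫ x, x ^ k ∂μ = ∫ x, x ^ k ∂ν) (K t : ℝ) :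
    ‖charFun μ t - charFun ν t‖ ≤
      (∫ x in {x : ℝ | |x| ≤ K}, |x| ^ (m + 1)
          ∂(μ.toSignedMeasure - ν.toSignedMeasure).variation)
        * (|t| ^ (m + 1) / (m + 1).factorial)
      + (∫ x in {x : ℝ | K < |x|}, |x| ^ m
          ∂(μ.toSignedMeasure - ν.toSignedMeasure).variation)
        * (2 * (|t| ^ m / m.factorial)) := by
  have := isFiniteMeasure_variation_sub μ ν
  set τ := (μ.toSignedMeasure - ν.toSignedMeasure).variation with hτ
  set R : ℝ → ℂ := fun x => expRemainder Complex.I (m + 1) (t * x) with hR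
  have hRμ : Integrable R μ := integrable_expRemainder μ t hμ
  have hRν : Integrable R ν := integrable_expRemainder ν t hν
  have hdiff : charFun μ t - charFun ν t = ∫ x, R x ∂μ - ∫ x, R x ∂ν := by
    rw [hR, integral_expRemainder μ t hμ, integral_expRemainder ν t hν]
    have : ∑ k ∈ Finset.range (m + 1),
          (t * Complex.I) ^ k / (k.factorial : ℂ) * ((∫ x, x ^ k ∂μ : ℝ) : ℂ) =
        ∑ k ∈ Finset.range (m + 1),
          (t * Complex.I) ^ k / (k.factorial : ℂ) * ((∫ x, x ^ k ∂ν : ℝ) : ℂ) :=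
      Finset.sum_congr rfl fun k hk => by
        rw [hmom k (Nat.lt_succ_iff.1 (Finset.mem_range.1 hk))]
    rw [this]
    ring
  have hRτ : Integrable (fun x => ‖R x‖) τ := integrable_variation_sub μ ν hRμ.norm hRν.norm
  have hmeas : MeasurableSet {x : ℝ | |x| ≤ K} := measurableSet_le (by fun_prop) (by fun_prop)
  have hcompl : {x : ℝ | |x| ≤ K}ᶜ = {x : ℝ | K < |x|} := by ext; simp
  rw [hdiff]
  refine (norm_integral_sub_integral_le_variation μ ν hRμ hRν).trans ?_
  rw [← integral_add_compl hmeas hRτ, hcompl, ← integral_mul_const, ← integral_mul_const]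
  refine add_le_add (setIntegral_mono_on hRτ.integrableOn ?_ hmeas fun x _ => ?_)
    (setIntegral_mono_on hRτ.integrableOn ?_ (hcompl ▸ hmeas.compl) fun x _ => ?_)
  -- No moment of order `m + 1` is assumed; boundedness on the truncated set and finiteness of the
  -- variation suffice.
  · have hK : IntegrableOn (fun x : ℝ => |x| ^ (m + 1)) {x : ℝ | |x| ≤ K} τ := by
      refine Measure.integrableOn_of_bounded (M := K ^ (m + 1)) (measure_ne_top _ _)
        (by fun_prop) ?_
      refine (ae_restrict_iff' hmeas).2 (.of_forall fun x hx => ?_)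
      rw [norm_pow, Real.norm_eq_abs, abs_abs]
      exact pow_le_pow_left₀ (abs_nonneg _) hx _
    exact Integrable.mul_const hK _
  · refine (norm_expRemainder_I_le (m + 1) (t * x)).trans_eq ?_
    rw [abs_mul, mul_pow]
    ring
  · have h := (integrable_variation_sub μ ν (hμ m le_rfl) (hν m le_rfl)).norm
    simp only [norm_pow, Real.norm_eq_abs] at h
    exact h.integrableOn.mul_const _
  · refine (norm_expRemainder_I_succ_le m (t * x)).trans_eq ?_
    rw [abs_mul, mul_pow]
    ring

end Moments

/-! ### Gaussian smoothing -/

section Smoothing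

open scoped NNReal Topology
open Filter

/-- The Gaussian kernel `exp (-v (x - y)² / 2)` averaged over a law `μ`, in terms of the
characteristic function of `μ`. -/
theorem integral_gaussianKernel_eq (μ : Measure ℝ) [IsProbabilityMeasure μ] (v : ℝ≥0) (y : ℝ) :
    ((∫ x, Real.exp (-(v * (x - y) ^ 2 / 2)) ∂μ : ℝ) : ℂ) =
      ∫ t, Complex.exp (-(t * y * Complex.I)) * charFun μ t ∂(gaussianReal 0 v) := by
  have hker : ∀ x : ℝ, ((Real.exp (-(v * (x - y) ^ 2 / 2)) : ℝ) : ℂ) =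
      ∫ t, Complex.exp (((x - y : ℝ) : ℂ) * (t : ℂ) * Complex.I) ∂(gaussianReal 0 v) := by
    intro x
    rw [← charFun_apply_real, charFun_gaussianReal]
    push_cast
    congr 1
    ring
  have hInt : Integrable (Function.uncurry fun x t : ℝ =>
      Complex.exp (((x - y : ℝ) : ℂ) * (t : ℂ) * Complex.I)) (μ.prod (gaussianReal 0 v)) := by
    refine Integrable.of_bound (C := 1) (Continuous.aestronglyMeasurable ?_)
      (.of_forall fun p => ?_)
    · unfold Function.uncurry
      fun_prop
    · have := Complex.norm_exp_ofReal_mul_I ((p.1 - y) * p.2)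
      push_cast at this
      simp [Function.uncurry, this]
  rw [← integral_complex_ofReal]
  simp_rw [hker]
  rw [integral_integral_swap hInt]
  congr 1 with t
  rw [charFun_apply_real, ← integral_const_mul]
  congr 1 with x
  rw [← Complex.exp_add]
  push_cast
  congr 1
  ring

theorem gaussianPDFReal_le (v : ℝ≥0) (t : ℝ) :
    gaussianPDFReal 0 v t ≤ (√(2 * Real.pi * v))⁻¹ := by
  rw [gaussianPDFReal]
  refine mul_le_of_le_one_right (by positivity) (Real.exp_le_one_iff.2 ?_)
  exact div_nonpos_of_nonpos_of_nonneg (neg_nonpos.2 (sq_nonneg _)) (by positivity)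

theorem integrable_gaussianReal_of_integrable {v : ℝ≥0} (hv : v ≠ 0) {f : ℝ → ℝ}
    (hf : Integrable f) : Integrable f (gaussianReal 0 v) := by
  rw [gaussianReal_of_var_ne_zero 0 hv,
    integrable_withDensity_iff (measurable_gaussianPDF 0 v) (.of_forall fun _ => gaussianPDF_lt_top)]
  simp only [toReal_gaussianPDF]
  refine hf.mul_bdd (c := (√(2 * Real.pi * v))⁻¹)
    (measurable_gaussianPDFReal 0 v).aestronglyMeasurable (.of_forall fun t => ?_)
  rw [Real.norm_of_nonneg (gaussianPDFReal_nonneg _ _ _)]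
  exact gaussianPDFReal_le v t

theorem integral_gaussianReal_le {v : ℝ≥0} (hv : v ≠ 0) {f : ℝ → ℝ} (hf0 : ∀ t, 0 ≤ f t)
    (hf : Integrable f) : ∫ t, f t ∂(gaussianReal 0 v) ≤ (√(2 * Real.pi * v))⁻¹ * ∫ t, f t := by
  rw [integral_gaussianReal_eq_integral_smul hv, ← integral_const_mul]
  refine integral_mono_of_nonneg (.of_forall fun t => ?_) (hf.const_mul _) (.of_forall fun t => ?_)
  · exact mul_nonneg (gaussianPDFReal_nonneg _ _ _) (hf0 t)
  · exact mul_le_mul_of_nonneg_right (gaussianPDFReal_le v t) (hf0 t)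

/-- A law with integrable characteristic function has no atoms. -/
theorem measureReal_singleton_eq_zero_of_integrable_charFun (μ : Measure ℝ)
    [IsProbabilityMeasure μ] (hμ : Integrable (charFun μ)) (y : ℝ) : μ.real {y} = 0 := by
  have hle : ∀ k : ℕ, μ.real {y} ≤
      (√(2 * Real.pi * ((k + 1 : ℕ) : ℝ≥0)))⁻¹ * ∫ t, ‖charFun μ t‖ := by
    intro k
    set v : ℝ≥0 := ((k + 1 : ℕ) : ℝ≥0)
    have hv : v ≠ 0 := by positivity
    -- The kernel equals `1` at `y`, so its average dominates the atom; on the Fourier side that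
    -- average is `O(v^(-1/2))`.
    have h1 : μ.real {y} ≤ ∫ x, Real.exp (-(v * (x - y) ^ 2 / 2)) ∂μ := by
      rw [← integral_indicator_one (measurableSet_singleton y)]
      refine integral_mono_of_nonneg (.of_forall fun x => ?_) ?_ (.of_forall fun x => ?_)
      · exact Set.indicator_nonneg (fun _ _ => zero_le_one) x
      · refine Integrable.of_bound (C := 1) (by fun_prop) (.of_forall fun x => ?_)
        rw [Real.norm_of_nonneg (Real.exp_nonneg _), Real.exp_le_one_iff]
        exact neg_nonpos.2 (by positivity)
      · by_cases hx : x = y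
        · simp [hx]
        · simp [hx, Real.exp_nonneg]
    refine h1.trans ((le_abs_self _).trans ?_)
    rw [← Real.norm_eq_abs, ← Complex.norm_real, integral_gaussianKernel_eq]
    refine (norm_integral_le_integral_norm _).trans (le_trans (le_of_eq ?_)
      (integral_gaussianReal_le hv (fun t => norm_nonneg _) hμ.norm))
    congr 1 with t
    have := Complex.norm_exp_ofReal_mul_I (-(t * y))
    push_cast at this
    rw [neg_mul] at this
    simp [this]
  refine le_antisymm (ge_of_tendsto' (x := atTop) ?_ hle) measureReal_nonneg
  rw [← zero_mul (∫ t, ‖charFun μ t‖)]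
  refine Tendsto.mul_const _ (tendsto_inv_atTop_zero.comp (Real.tendsto_sqrt_atTop.comp ?_))
  refine Tendsto.const_mul_atTop (by positivity) ?_
  simp only [NNReal.coe_natCast]
  exact tendsto_natCast_atTop_atTop.comp (tendsto_add_atTop_nat 1)

theorem norm_intervalIntegral_exp_le (t a b : ℝ) (ht : t ≠ 0) :
    ‖∫ y in a..b, Complex.exp (-(t * y * Complex.I))‖ ≤ 2 / |t| := by
  have hc : -((t : ℂ) * Complex.I) ≠ 0 := by simp [ht]
  have heq : ∀ y : ℝ, Complex.exp (-(t * y * Complex.I)) =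
      Complex.exp (-((t : ℂ) * Complex.I) * y) := fun y => by congr 1; ring
  have hn : ∀ y : ℝ, ‖Complex.exp (-((t : ℂ) * Complex.I) * y)‖ = 1 := fun y => by
    have := Complex.norm_exp_ofReal_mul_I (-(t * y))
    rw [← this]
    congr 2
    push_cast
    ring
  simp_rw [heq]
  rw [integral_exp_mul_complex hc, norm_div]
  simp only [norm_neg, norm_mul, Complex.norm_I, mul_one, Complex.norm_real, Real.norm_eq_abs]
  gcongr
  refine (norm_sub_le _ _).trans ?_
  rw [hn, hn]
  norm_num

/-- The smoothed masses that two laws give to an interval differ by at most a multiple of the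
integral of `‖charFun μ t - charFun ν t‖ / |t|`. -/
theorem abs_intervalIntegral_gaussianKernel_sub_le (μ ν : Measure ℝ) [IsProbabilityMeasure μ]
    [IsProbabilityMeasure ν] {D : ℝ → ℝ} (hD0 : ∀ t, 0 ≤ D t) (hD : Integrable D)
    (hb : ∀ t, ‖charFun μ t - charFun ν t‖ ≤ |t| * D t) {v : ℝ≥0} (hv : v ≠ 0) (a b : ℝ) :
    |∫ y in a..b, ((∫ x, Real.exp (-(v * (x - y) ^ 2 / 2)) ∂μ)
        - ∫ x, Real.exp (-(v * (x - y) ^ 2 / 2)) ∂ν)| ≤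
      2 * ((√(2 * Real.pi * v))⁻¹ * ∫ t, D t) := by
  have hnorm : ∀ t y : ℝ, ‖Complex.exp (-(t * y * Complex.I))‖ = 1 := fun t y => by
    have := Complex.norm_exp_ofReal_mul_I (-(t * y))
    push_cast at this
    rw [neg_mul] at this
    exact this
  have hchar : ∀ (κ : Measure ℝ) [IsProbabilityMeasure κ] (y : ℝ), Integrable
      (fun t : ℝ => Complex.exp (-(t * y * Complex.I)) * charFun κ t) (gaussianReal 0 v) := by
    intro κ _ y
    refine Integrable.of_bound (C := 1) ?_ (.of_forall fun t => ?_)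
    · exact (Continuous.aestronglyMeasurable (by fun_prop)).mul
        measurable_charFun.aestronglyMeasurable
    · rw [norm_mul, hnorm, one_mul]
      exact norm_charFun_le_one t
  have hdiff : ∀ y : ℝ, (((∫ x, Real.exp (-(v * (x - y) ^ 2 / 2)) ∂μ)
        - ∫ x, Real.exp (-(v * (x - y) ^ 2 / 2)) ∂ν : ℝ) : ℂ) =
      ∫ t, Complex.exp (-(t * y * Complex.I)) * (charFun μ t - charFun ν t)
        ∂(gaussianReal 0 v) := by
    intro y
    rw [Complex.ofReal_sub, integral_gaussianKernel_eq, integral_gaussianKernel_eq,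
      ← integral_sub (hchar μ y) (hchar ν y)]
    simp_rw [mul_sub]
  have hInt : Integrable (Function.uncurry fun y t : ℝ =>
      Complex.exp (-(t * y * Complex.I)) * (charFun μ t - charFun ν t))
      ((volume.restrict (Set.uIoc a b)).prod (gaussianReal 0 v)) := by
    have : IsFiniteMeasure (volume.restrict (Set.uIoc a b)) :=
      isFiniteMeasure_restrict.2 (by simp [Set.uIoc])
    refine Integrable.of_bound (C := 2) ?_ (.of_forall fun p => ?_)
    · unfold Function.uncurry
      refine (Continuous.aestronglyMeasurable (by fun_prop)).mul ?_
      exact ((measurable_charFun.sub measurable_charFun).comp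
        measurable_snd).aestronglyMeasurable
    · simp only [Function.uncurry, norm_mul, hnorm, one_mul]
      refine (norm_sub_le _ _).trans ?_
      linarith [norm_charFun_le_one (μ := μ) p.2, norm_charFun_le_one (μ := ν) p.2]
  rw [← Real.norm_eq_abs, ← Complex.norm_real, ← intervalIntegral.integral_ofReal]
  simp_rw [hdiff]
  rw [intervalIntegral_integral_swap hInt]
  have hDv := (integrable_gaussianReal_of_integrable hv hD).const_mul 2
  calc ‖∫ t : ℝ, (∫ y in a..b, Complex.exp (-(t * y * Complex.I)) * (charFun μ t - charFun ν t))
          ∂(gaussianReal 0 v)‖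
      ≤ ∫ t, 2 * D t ∂(gaussianReal 0 v) := by
        refine norm_integral_le_of_norm_le hDv (.of_forall fun t => ?_)
        rw [intervalIntegral.integral_mul_const, norm_mul]
        -- At `t = 0` the hypothesis `hb` forces the difference to vanish; elsewhere the factor `2 /
        -- |t|` cancels `|t|`.
        by_cases ht : t = 0
        · have h0 : ‖charFun μ t - charFun ν t‖ ≤ 0 := by simp [ht]
          rw [le_antisymm h0 (norm_nonneg _), mul_zero]
          linarith [hD0 t]
        · calc _ ≤ 2 / |t| * (|t| * D t) :=
                mul_le_mul (norm_intervalIntegral_exp_le t a b ht) (hb t) (norm_nonneg _)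
                  (by positivity)
            _ = 2 * D t := by
                have := abs_pos.2 ht
                field_simp
    _ ≤ 2 * ((√(2 * Real.pi * v))⁻¹ * ∫ t, D t) := by
        rw [integral_const_mul]
        exact mul_le_mul_of_nonneg_left (integral_gaussianReal_le hv hD0 hD) (by norm_num)

theorem intervalIntegral_gaussianPDFReal (a b : ℝ) :
    ∫ z in a..b, gaussianPDFReal 0 1 z = cdf (gaussianReal 0 1) b - cdf (gaussianReal 0 1) a := by
  have h : ∀ c : ℝ, cdf (gaussianReal 0 1) c = ∫ z in Set.Iic c, gaussianPDFReal 0 1 z := by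
    intro c
    rw [cdf_eq_real, measureReal_def, gaussianReal_apply_eq_integral 0 one_ne_zero,
      ENNReal.toReal_ofReal]
    exact integral_nonneg fun z => gaussianPDFReal_nonneg _ _ _
  rw [h, h, intervalIntegral.integral_Iic_sub_Iic] <;>
  exact (integrable_gaussianPDFReal 0 1).integrableOn

theorem intervalIntegral_gaussianKernel {k : ℝ} (hk : 0 < k) (x a b : ℝ) :
    ∫ y in a..b, Real.exp (-(k ^ 2 * (x - y) ^ 2 / 2)) =
      √(2 * Real.pi) / k * (cdf (gaussianReal 0 1) (k * (b - x))
        - cdf (gaussianReal 0 1) (k * (a - x))) := by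
  have h : ∀ y : ℝ, Real.exp (-(k ^ 2 * (x - y) ^ 2 / 2)) =
      √(2 * Real.pi) * gaussianPDFReal 0 1 (k * y - k * x) := by
    intro y
    have : √(2 * Real.pi) ≠ 0 := by positivity
    rw [gaussianPDFReal]
    simp only [NNReal.coe_one, mul_one, sub_zero]
    rw [mul_inv_cancel_left₀ this]
    congr 1
    ring
  simp_rw [h]
  rw [intervalIntegral.integral_const_mul, intervalIntegral.integral_comp_mul_sub _ hk.ne',
    intervalIntegral_gaussianPDFReal, smul_eq_mul, ← mul_sub, ← mul_sub]
  ring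

theorem intervalIntegral_integral_gaussianKernel (μ : Measure ℝ) [IsProbabilityMeasure μ] {k : ℝ}
    (hk : 0 < k) (a b : ℝ) :
    ∫ y in a..b, ∫ x, Real.exp (-(k ^ 2 * (x - y) ^ 2 / 2)) ∂μ =
      √(2 * Real.pi) / k * ∫ x, (cdf (gaussianReal 0 1) (k * (b - x))
        - cdf (gaussianReal 0 1) (k * (a - x))) ∂μ := by
  rw [intervalIntegral_integral_swap, ← integral_const_mul]
  · simp_rw [intervalIntegral_gaussianKernel hk]
  · have : IsFiniteMeasure (volume.restrict (Set.uIoc a b)) :=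
      isFiniteMeasure_restrict.2 (by simp [Set.uIoc])
    refine Integrable.of_bound (C := 1) (Continuous.aestronglyMeasurable ?_)
      (.of_forall fun p => ?_)
    · unfold Function.uncurry
      fun_prop
    · rw [Function.uncurry, Real.norm_of_nonneg (Real.exp_nonneg _), Real.exp_le_one_iff]
      exact neg_nonpos.2 (by positivity)

/-- The integrand tends to the indicator of `x < b` except at `x = b`, which carries no mass. Kernel
width `1 / k` and left endpoint `-k` are sent to their limits together, so one dominated convergence
suffices. -/
theorem tendsto_integral_cdf_sub (μ : Measure ℝ) [IsProbabilityMeasure μ] {b : ℝ}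
    (hμb : μ.real {b} = 0) :
    Tendsto (fun k : ℕ => ∫ x, (cdf (gaussianReal 0 1) ((k : ℝ) * (b - x))
        - cdf (gaussianReal 0 1) ((k : ℝ) * (-(k : ℝ) - x))) ∂μ) atTop
      (𝓝 (μ.real (Set.Iio b))) := by
  rw [← integral_indicator_one measurableSet_Iio]
  refine tendsto_integral_of_dominated_convergence (fun _ => 1) (fun k => ?_)
    (integrable_const _) (fun k => .of_forall fun x => ?_) ?_
  · refine Measurable.aestronglyMeasurable (Measurable.sub ?_ ?_)
    · exact (monotone_cdf _).measurable.comp (by fun_prop)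
    · exact (monotone_cdf _).measurable.comp (by fun_prop)
  · rw [Real.norm_eq_abs, abs_le]
    constructor <;>
    linarith [cdf_nonneg (gaussianReal 0 1) ((k : ℝ) * (b - x)),
      cdf_le_one (gaussianReal 0 1) ((k : ℝ) * (b - x)),
      cdf_nonneg (gaussianReal 0 1) ((k : ℝ) * (-(k : ℝ) - x)),
      cdf_le_one (gaussianReal 0 1) ((k : ℝ) * (-(k : ℝ) - x))]
  · have hne : ∀ᵐ x ∂μ, x ≠ b := by
      have : μ {b} = 0 := (measureReal_eq_zero_iff).1 hμb
      exact compl_mem_ae_iff.2 this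
    filter_upwards [hne] with x hx
    have hcast : Tendsto (fun k : ℕ => (k : ℝ)) atTop atTop := tendsto_natCast_atTop_atTop
    have hlow : Tendsto (fun k : ℕ => cdf (gaussianReal 0 1) ((k : ℝ) * (-(k : ℝ) - x))) atTop
        (𝓝 0) := by
      refine (tendsto_cdf_atBot _).comp (hcast.atTop_mul_atBot₀ ?_)
      exact tendsto_atBot_add_const_right _ (-x) (tendsto_neg_atTop_atBot.comp hcast)
    rcases lt_or_gt_of_ne hx with h | h
    · have hup : Tendsto (fun k : ℕ => cdf (gaussianReal 0 1) ((k : ℝ) * (b - x))) atTop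
          (𝓝 1) :=
        (tendsto_cdf_atTop _).comp (hcast.atTop_mul_const (by linarith))
      simpa [Set.indicator, h] using hup.sub hlow
    · have hup : Tendsto (fun k : ℕ => cdf (gaussianReal 0 1) ((k : ℝ) * (b - x))) atTop
          (𝓝 0) :=
        (tendsto_cdf_atBot _).comp (hcast.atTop_mul_const_of_neg (by linarith))
      simpa [Set.indicator, h.not_gt] using hup.sub hlow

/-- Smoothing inequality: the distance of two distribution functions at a common point of
continuity is bounded through the characteristic functions. -/
theorem abs_measureReal_Iio_sub_le (μ ν : Measure ℝ) [IsProbabilityMeasure μ]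
    [IsProbabilityMeasure ν] {D : ℝ → ℝ} (hD0 : ∀ t, 0 ≤ D t) (hD : Integrable D)
    (hb : ∀ t, ‖charFun μ t - charFun ν t‖ ≤ |t| * D t) {x : ℝ}
    (hμx : μ.real {x} = 0) (hνx : ν.real {x} = 0) :
    |μ.real (Set.Iio x) - ν.real (Set.Iio x)| ≤ (∫ t, D t) / Real.pi := by
  refine le_of_tendsto
    ((tendsto_integral_cdf_sub μ hμx).sub (tendsto_integral_cdf_sub ν hνx)).abs ?_
  filter_upwards [eventually_gt_atTop 0] with k hk
  have hk' : (0 : ℝ) < k := by exact_mod_cast hk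
  have hv : ((k : ℝ≥0) ^ 2) ≠ 0 := by positivity
  have h := abs_intervalIntegral_gaussianKernel_sub_le μ ν hD0 hD hb hv (-(k : ℝ)) x
  have hcont : ∀ (κ : Measure ℝ) [IsProbabilityMeasure κ], Continuous fun y : ℝ =>
      ∫ z, Real.exp (-((k : ℝ) ^ 2 * (z - y) ^ 2 / 2)) ∂κ := by
    intro κ _
    refine continuous_of_dominated (bound := fun _ => 1) (fun y => by fun_prop)
      (fun y => .of_forall fun z => ?_) (integrable_const _) (.of_forall fun z => by fun_prop)
    rw [Real.norm_of_nonneg (Real.exp_nonneg _), Real.exp_le_one_iff]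
    exact neg_nonpos.2 (by positivity)
  simp only [NNReal.coe_pow, NNReal.coe_natCast] at h
  rw [intervalIntegral.integral_sub ((hcont μ).intervalIntegrable _ _)
    ((hcont ν).intervalIntegrable _ _), intervalIntegral_integral_gaussianKernel μ hk',
    intervalIntegral_integral_gaussianKernel ν hk', ← mul_sub, abs_mul,
    abs_of_nonneg (by positivity), Real.sqrt_mul (show 0 ≤ 2 * Real.pi by positivity),
    Real.sqrt_sq hk'.le] at h
  have hs : (0 : ℝ) < √(2 * Real.pi) := by positivity
  have hss : √(2 * Real.pi) * √(2 * Real.pi) = 2 * Real.pi :=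
    Real.mul_self_sqrt (by positivity)
  rw [← mul_le_mul_iff_right₀ (show 0 < √(2 * Real.pi) / (k : ℝ) by positivity)]
  refine h.trans (le_of_eq ?_)
  have hpi := Real.pi_pos
  field_simp
  rw [Real.sq_sqrt (by positivity)]

end Smoothing

/-! ### Characteristic functions away from the origin -/

section AwayFromZero

theorem abs_sin_natCast_mul_le (k : ℕ) (x : ℝ) : |Real.sin (k * x)| ≤ k * |Real.sin x| := by
  induction k with
  | zero => simp
  | succ k ih =>
    push_cast
    rw [add_mul, one_mul, Real.sin_add]
    calc |Real.sin (k * x) * Real.cos x + Real.cos (k * x) * Real.sin x|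
        ≤ |Real.sin (k * x)| * |Real.cos x| + |Real.cos (k * x)| * |Real.sin x| := by
          rw [← abs_mul, ← abs_mul]
          exact abs_add_le _ _
      _ ≤ k * |Real.sin x| * 1 + 1 * |Real.sin x| := by
          gcongr
          · exact Real.abs_cos_le_one x
          · exact Real.abs_cos_le_one _
      _ = (k + 1) * |Real.sin x| := by ring

theorem one_sub_cos_eq (x : ℝ) : 1 - Real.cos x = 2 * Real.sin (x / 2) ^ 2 := by
  have h := Real.cos_sq' (x / 2)
  have h2 := Real.cos_two_mul (x / 2)
  rw [mul_div_cancel₀ x (two_ne_zero)] at h2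
  linarith

/-- In half angles this is `|sin (k u + w)| ≤ k |sin u| + |sin w|`, squared with `(p + q)² ≤ 2p² +
2q²`. -/
theorem one_sub_cos_natCast_mul_add_le (k : ℕ) (x y : ℝ) :
    1 - Real.cos (k * x + y) ≤ 2 * (k : ℝ) ^ 2 * (1 - Real.cos x) + 2 * (1 - Real.cos y) := by
  rw [one_sub_cos_eq, one_sub_cos_eq x, one_sub_cos_eq y]
  have h1 : |Real.sin ((k * x + y) / 2)| ≤ k * |Real.sin (x / 2)| + |Real.sin (y / 2)| := by
    have hs : (k * x + y) / 2 = k * (x / 2) + y / 2 := by ring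
    rw [hs, Real.sin_add]
    calc |Real.sin (k * (x / 2)) * Real.cos (y / 2) + Real.cos (k * (x / 2)) * Real.sin (y / 2)|
        ≤ |Real.sin (k * (x / 2))| * |Real.cos (y / 2)|
            + |Real.cos (k * (x / 2))| * |Real.sin (y / 2)| := by
          rw [← abs_mul, ← abs_mul]
          exact abs_add_le _ _
      _ ≤ k * |Real.sin (x / 2)| * 1 + 1 * |Real.sin (y / 2)| := by
          gcongr
          · exact abs_sin_natCast_mul_le k _
          · exact Real.abs_cos_le_one _
          · exact Real.abs_cos_le_one _
      _ = _ := by ring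
  have h2 : Real.sin ((k * x + y) / 2) ^ 2 ≤
      (k * |Real.sin (x / 2)| + |Real.sin (y / 2)|) ^ 2 := by
    rw [← sq_abs]
    exact pow_le_pow_left₀ (abs_nonneg _) h1 2
  have h3 := sq_nonneg (k * |Real.sin (x / 2)| - |Real.sin (y / 2)|)
  rw [← sq_abs (Real.sin (x / 2)), ← sq_abs (Real.sin (y / 2))]
  nlinarith

variable (μ : Measure ℝ) [IsProbabilityMeasure μ]

theorem integrable_cos_mul_sub (t : ℝ) :
    Integrable (fun p : ℝ × ℝ => Real.cos (t * (p.1 - p.2))) (μ.prod μ) :=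
  Integrable.of_bound (C := 1) (by fun_prop) (.of_forall fun p => by
    rw [Real.norm_eq_abs]
    exact Real.abs_cos_le_one _)

/-- Symmetrization: `|g|²` is the characteristic function of `X - X'` with `X'` an independent copy
of `X`. -/
theorem norm_charFun_sq (t : ℝ) :
    ‖charFun μ t‖ ^ 2 = ∫ p : ℝ × ℝ, Real.cos (t * (p.1 - p.2)) ∂(μ.prod μ) := by
  have h1 : ((‖charFun μ t‖ ^ 2 : ℝ) : ℂ) = charFun μ t * charFun μ (-t) := by
    rw [charFun_neg, Complex.mul_conj']
    push_cast
    rfl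
  have h2 : charFun μ t * charFun μ (-t) =
      ∫ p : ℝ × ℝ, Complex.exp (((t * (p.1 - p.2) : ℝ) : ℂ) * Complex.I) ∂(μ.prod μ) := by
    rw [charFun_apply_real, charFun_apply_real, ← integral_prod_mul]
    congr 1 with p
    rw [← Complex.exp_add]
    push_cast
    congr 1
    ring
  have hInt : Integrable (fun p : ℝ × ℝ =>
      Complex.exp (((t * (p.1 - p.2) : ℝ) : ℂ) * Complex.I)) (μ.prod μ) := by
    refine Integrable.of_bound (C := 1) (by fun_prop) (.of_forall fun p => ?_)
    rw [Complex.norm_exp_ofReal_mul_I]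
  have h3 := congrArg Complex.re (h1.trans h2)
  rw [Complex.ofReal_re] at h3
  rw [h3, ← Complex.reCLM_apply, ← ContinuousLinearMap.integral_comp_comm _ hInt]
  congr 1 with p
  rw [Complex.reCLM_apply, Complex.exp_ofReal_mul_I_re]

theorem one_sub_norm_charFun_sq (t : ℝ) :
    1 - ‖charFun μ t‖ ^ 2 = ∫ p : ℝ × ℝ, (1 - Real.cos (t * (p.1 - p.2))) ∂(μ.prod μ) := by
  rw [integral_sub (integrable_const _) (integrable_cos_mul_sub μ t), norm_charFun_sq]
  simp

variable {μ}

theorem integrable_sub_sq (hL2 : MemLp id 2 μ) :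
    Integrable (fun p : ℝ × ℝ => (p.1 - p.2) ^ 2) (μ.prod μ) :=
  ((hL2.comp_fst μ).sub (hL2.comp_snd μ)).integrable_sq

theorem integral_sub_sq (hL2 : MemLp id 2 μ) (hmean : ∫ x, x ∂μ = 0) (hvar : ∫ x, x ^ 2 ∂μ = 1) :
    ∫ p : ℝ × ℝ, (p.1 - p.2) ^ 2 ∂(μ.prod μ) = 2 := by
  have hid : Integrable (fun x : ℝ => x) μ := hL2.integrable one_le_two
  have hsq : Integrable (fun x : ℝ => x ^ 2) μ := hL2.integrable_sq
  have h : ∀ p : ℝ × ℝ, (p.1 - p.2) ^ 2 = p.1 ^ 2 + p.2 ^ 2 - 2 * (p.1 * p.2) := fun p => by ring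
  simp_rw [h]
  have hadd : Integrable (fun p : ℝ × ℝ => p.1 ^ 2 + p.2 ^ 2) (μ.prod μ) :=
    (hsq.comp_fst μ).add (hsq.comp_snd μ)
  rw [integral_sub hadd ((hid.mul_prod hid).const_mul 2),
    integral_add (hsq.comp_fst μ) (hsq.comp_snd μ), integral_const_mul,
    integral_prod_mul (fun x : ℝ => x) (fun x : ℝ => x),
    integral_fun_fst (fun x : ℝ => x ^ 2), integral_fun_snd (fun x : ℝ => x ^ 2)]
  simp [hmean, hvar]
  norm_num

/-- Integrate the cosine inequality over `X - X'`; the shift costs `s² E(X - X')² = 2 s²`. -/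
theorem one_sub_norm_charFun_sq_le (hL2 : MemLp id 2 μ) (hmean : ∫ x, x ∂μ = 0)
    (hvar : ∫ x, x ^ 2 ∂μ = 1) (k : ℕ) (t s : ℝ) :
    1 - ‖charFun μ (k * t + s)‖ ^ 2 ≤
      2 * (k : ℝ) ^ 2 * (1 - ‖charFun μ t‖ ^ 2) + 2 * s ^ 2 := by
  have hc : ∀ t : ℝ, Integrable (fun p : ℝ × ℝ => 1 - Real.cos (t * (p.1 - p.2))) (μ.prod μ) :=
    fun t => (integrable_const _).sub (integrable_cos_mul_sub μ t)
  have hsq := integrable_sub_sq hL2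
  have hs : 2 * s ^ 2 = ∫ p : ℝ × ℝ, s ^ 2 * (p.1 - p.2) ^ 2 ∂(μ.prod μ) := by
    rw [integral_const_mul, integral_sub_sq hL2 hmean hvar]
    ring
  rw [one_sub_norm_charFun_sq, one_sub_norm_charFun_sq, hs, ← integral_const_mul,
    ← integral_add ((hc t).const_mul _) (hsq.const_mul _)]
  refine integral_mono (hc _) (((hc t).const_mul _).add (hsq.const_mul _)) fun p => ?_
  have h1 := one_sub_cos_natCast_mul_add_le k (t * (p.1 - p.2)) (s * (p.1 - p.2))
  have h2 := Real.one_sub_sq_div_two_le_cos (x := s * (p.1 - p.2))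
  have h3 : (k * t + s) * (p.1 - p.2) = k * (t * (p.1 - p.2)) + s * (p.1 - p.2) := by ring
  simp only [h3]
  nlinarith

/-- If `‖charFun μ t‖` is close to `1` then `charFun μ` is large near the first multiples of `t`,
which makes its `L¹` norm large. -/
theorem le_integral_norm_charFun (hInt : Integrable (charFun μ)) (hL2 : MemLp id 2 μ)
    (hmean : ∫ x, x ∂μ = 0) (hvar : ∫ x, x ^ 2 ∂μ = 1) {t : ℝ} (ht : 1 ≤ t) (K : ℕ)
    (hK : (K : ℝ) ^ 2 * (1 - ‖charFun μ t‖ ^ 2) ≤ 4 / 25) :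
    12 / 25 * ((K : ℝ) + 1) ≤ ∫ s, ‖charFun μ s‖ := by
  -- On `J k` the loss `1 - |g|²` is at most `8/25 + 8/25 = 16/25`, so `|g| ≥ 3/5`. Each interval
  -- contributes `4/5 · 3/5 = 12/25`, and they are disjoint because `4/5 < 1 ≤ t`.
  set J : ℕ → Set ℝ := fun k => Set.Icc (k * t - 2 / 5) (k * t + 2 / 5) with hJ
  have hδ : 0 ≤ 1 - ‖charFun μ t‖ ^ 2 := by
    have := norm_charFun_le_one (μ := μ) t
    nlinarith [norm_nonneg (charFun μ t)]
  have hlow : ∀ k ∈ Finset.range (K + 1), ∀ s ∈ J k, 3 / 5 ≤ ‖charFun μ s‖ := by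
    intro k hk s hs
    have hkK : (k : ℝ) ≤ K := by exact_mod_cast Nat.lt_succ_iff.1 (Finset.mem_range.1 hk)
    have h := one_sub_norm_charFun_sq_le hL2 hmean hvar k t (s - k * t)
    rw [add_sub_cancel] at h
    have h1 : (k : ℝ) ^ 2 * (1 - ‖charFun μ t‖ ^ 2) ≤ 4 / 25 :=
      (mul_le_mul_of_nonneg_right (pow_le_pow_left₀ (by positivity) hkK 2) hδ).trans hK
    have h2 : (s - k * t) ^ 2 ≤ 4 / 25 := by
      have := abs_le.2 (⟨by linarith [hs.1], by linarith [hs.2]⟩ :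
        -(2 / 5) ≤ s - k * t ∧ s - k * t ≤ 2 / 5)
      rw [← sq_abs]
      nlinarith [abs_nonneg (s - k * t)]
    nlinarith [norm_nonneg (charFun μ s)]
  have hdisj : Set.PairwiseDisjoint (↑(Finset.range (K + 1))) J := by
    intro i _ j _ hij
    rw [Function.onFun, Set.disjoint_left]
    intro s hi hj
    rcases lt_or_gt_of_ne hij with h | h
    · have : (i : ℝ) + 1 ≤ j := by exact_mod_cast h
      nlinarith [hi.2, hj.1]
    · have : (j : ℝ) + 1 ≤ i := by exact_mod_cast h
      nlinarith [hj.2, hi.1]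
  have hunion : ∫ s in ⋃ k ∈ Finset.range (K + 1), J k, ‖charFun μ s‖ =
      ∑ k ∈ Finset.range (K + 1), ∫ s in J k, ‖charFun μ s‖ :=
    integral_biUnion_finset _ (fun k _ => measurableSet_Icc) hdisj
      (fun k _ => hInt.norm.integrableOn)
  have hJle : ∀ k ∈ Finset.range (K + 1), (12 / 25 : ℝ) ≤ ∫ s in J k, ‖charFun μ s‖ := by
    intro k hk
    have h := setIntegral_mono_on (f := fun _ => (3 / 5 : ℝ)) (s := J k) (μ := volume)
      (integrableOn_const (by simp [hJ])) hInt.norm.integrableOn measurableSet_Icc (hlow k hk)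
    refine le_trans (le_of_eq ?_) h
    rw [setIntegral_const, hJ, Real.volume_real_Icc_of_le (by linarith), smul_eq_mul]
    ring
  calc 12 / 25 * ((K : ℝ) + 1) = ∑ k ∈ Finset.range (K + 1), (12 / 25 : ℝ) := by
        simp
        ring
    _ ≤ ∑ k ∈ Finset.range (K + 1), ∫ s in J k, ‖charFun μ s‖ := Finset.sum_le_sum hJle
    _ = ∫ s in ⋃ k ∈ Finset.range (K + 1), J k, ‖charFun μ s‖ := hunion.symm
    _ ≤ ∫ s, ‖charFun μ s‖ :=
        setIntegral_le_integral hInt.norm (.of_forall fun s => norm_nonneg _)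

/-- A centred law of unit variance with integrable characteristic function `g` satisfies
`|g t| ≤ b` for `|t| ≥ 1`. -/
theorem norm_charFun_le_bConst (hInt : Integrable (charFun μ)) (hL2 : MemLp id 2 μ)
    (hmean : ∫ x, x ∂μ = 0) (hvar : ∫ x, x ^ 2 ∂μ = 1) {t : ℝ} (ht : 1 ≤ |t|) :
    ‖charFun μ t‖ ≤ Pseudomoments.bConst (∫ s, ‖charFun μ s‖) 1 := by
  wlog hpos : 0 ≤ t generalizing t
  · have h := this (t := -t) (by rwa [abs_neg]) (by linarith)
    rwa [charFun_neg, RCLike.norm_conj] at h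
  rw [abs_of_nonneg hpos] at ht
  set A := ∫ s, ‖charFun μ s‖ with hA
  have hkey := fun K => le_integral_norm_charFun hInt hL2 hmean hvar ht K
  have hApos : 12 / 25 ≤ A := by simpa using hkey 0 (by norm_num)
  set d := 1 - ‖charFun μ t‖ ^ 2 with hd
  have hd0 : 0 ≤ d := by
    have := norm_charFun_le_one (μ := μ) t
    nlinarith [norm_nonneg (charFun μ t)]
  have hd1 : 0 < d := by
    rcases hd0.eq_or_lt with h | h
    · exfalso
      obtain ⟨K, hK⟩ := exists_nat_gt (25 / 12 * A)
      have := hkey K (by rw [← h]; norm_num)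
      linarith
    · exact h
  set r := √d with hr
  have hr0 : 0 < r := Real.sqrt_pos.2 hd1
  have hrd : r ^ 2 = d := Real.sq_sqrt hd0
  have hfl : (⌊2 / 5 / r⌋₊ : ℝ) ≤ 2 / 5 / r := Nat.floor_le (by positivity)
  have hfl' := Nat.lt_floor_add_one (2 / 5 / r)
  -- `K = ⌊2 / (5r)⌋` is the largest number of multiples allowed by `K² d ≤ 4/25`; then `K + 1 > 2 /
  -- (5r)` gives `A ≥ 12/25 · 2 / (5r)`.
  have hAr : 24 / 125 ≤ A * r := by
    have h := hkey ⌊2 / 5 / r⌋₊ (by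
      rw [← hrd, ← mul_pow]
      rw [le_div_iff₀ hr0] at hfl
      nlinarith [show 0 ≤ (⌊2 / 5 / r⌋₊ : ℝ) * r by positivity])
    rw [div_lt_iff₀ hr0] at hfl'
    nlinarith
  have hpi := Real.pi_pos
  have hexp : Real.pi ^ 2 / (24 * A ^ 2 * 1 ^ 2 * (2 + Real.pi) ^ 2) ≤ d / 2 := by
    -- The constant `33/50` must satisfy `(33/50)² ≤ 12 (24/125)²`, that is `0.4356 ≤ 0.4424`.
    have h1 : Real.pi ≤ 33 / 50 * (2 + Real.pi) := by linarith [Real.pi_lt_d2]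
    have h2 : Real.pi ^ 2 ≤ (33 / 50 * (2 + Real.pi)) ^ 2 := pow_le_pow_left₀ hpi.le h1 2
    have h3 : (24 / 125 : ℝ) ^ 2 ≤ A ^ 2 * d := by
      rw [← hrd, ← mul_pow]
      exact pow_le_pow_left₀ (by norm_num) hAr 2
    rw [div_le_iff₀ (by positivity)]
    nlinarith [mul_le_mul_of_nonneg_right h3 (sq_nonneg (2 + Real.pi))]
  have hsq : ‖charFun μ t‖ ^ 2 ≤ Real.exp (-(d / 2)) ^ 2 := by
    rw [← Real.exp_nat_mul]
    have := Real.add_one_le_exp (-d)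
    have h2 : ((2 : ℕ) : ℝ) * -(d / 2) = -d := by push_cast; ring
    rw [h2]
    linarith
  refine (pow_le_pow_iff_left₀ (norm_nonneg _) (Real.exp_nonneg _) two_ne_zero).1 hsq |>.trans ?_
  exact Real.exp_le_exp.2 (neg_le_neg hexp)

end AwayFromZero

/-! ### Elementary estimates -/

section Elementary

open Filter Topology

theorem pow_div_factorial_anti {t : ℝ} (ht : 0 ≤ t) {j k : ℕ} (hj : t ≤ j) (hjk : j ≤ k) :
    t ^ k / k.factorial ≤ t ^ j / j.factorial := by
  induction k, hjk using Nat.le_induction with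
  | base => exact le_rfl
  | succ k hk ih =>
    refine le_trans ?_ ih
    have hk' : t ≤ (k : ℝ) + 1 := by
      have : (j : ℝ) ≤ k := by exact_mod_cast hk
      linarith
    rw [Nat.factorial_succ, pow_succ]
    push_cast
    rw [div_le_div_iff₀ (by positivity) (by positivity)]
    have : 0 ≤ t ^ k * (k.factorial : ℝ) := by positivity
    nlinarith

theorem pow_div_factorial_le_exp_sub_one {t : ℝ} (ht : 0 ≤ t) {k : ℕ} (hk : 1 ≤ k) :
    t ^ k / k.factorial ≤ Real.exp t - 1 := by
  have h := Real.sum_le_exp_of_nonneg ht (k + 1)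
  rw [Finset.sum_range_succ] at h
  have h1 : (1 : ℝ) ≤ ∑ i ∈ Finset.range k, t ^ i / i.factorial := by
    refine le_trans (le_of_eq (by simp)) (Finset.single_le_sum
      (f := fun i => t ^ i / (i.factorial : ℝ)) (fun i _ => by positivity)
      (Finset.mem_range.2 (by lia : 0 < k)))
  linarith

/-- For `t ≤ 3` the left side is largest at `m = 3`, where it is at most `t² + t⁴ / 24`, below the
quadratic expansion of the right side. For `t ≥ 3` each quotient is at most `exp t - 1`, and `t ≤ t²
/ 3`. -/
theorem pow_div_factorial_add_le {m : ℕ} (hm : 3 ≤ m) {t : ℝ} (ht : 0 ≤ t) :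
    t ^ (m + 1) / (m + 1).factorial + 2 * (t ^ m / m.factorial) ≤
      3 * (Real.exp (t ^ 2 / 3) - 1) := by
  rcases le_total t 3 with h | h
  · have h1 := pow_div_factorial_anti ht (j := 3) (by exact_mod_cast h) hm
    have h2 := pow_div_factorial_anti ht (j := 4) (k := m + 1) (by push_cast; linarith) (by lia)
    have h3 := Real.quadratic_le_exp_of_nonneg (x := t ^ 2 / 3) (by positivity)
    have e3 : ((Nat.factorial 3 : ℕ) : ℝ) = 6 := by norm_num [Nat.factorial]
    have e4 : ((Nat.factorial 4 : ℕ) : ℝ) = 24 := by norm_num [Nat.factorial]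
    rw [e3] at h1
    rw [e4] at h2
    have h4 : t ^ 3 ≤ 3 * t ^ 2 := by nlinarith [sq_nonneg t]
    have h5 : 0 ≤ t ^ 4 := by positivity
    nlinarith
  · have h1 := pow_div_factorial_le_exp_sub_one ht (k := m) (by lia)
    have h2 := pow_div_factorial_le_exp_sub_one ht (k := m + 1) (by lia)
    have h3 : Real.exp t ≤ Real.exp (t ^ 2 / 3) := Real.exp_le_exp.2 (by nlinarith)
    linarith

theorem norm_pow_sub_pow_le {z w : ℂ} {M : ℝ} (hz : ‖z‖ ≤ M) (hw : ‖w‖ ≤ M) (n : ℕ) :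
    ‖z ^ n - w ^ n‖ ≤ n * ‖z - w‖ * M ^ (n - 1) := by
  have hM : 0 ≤ M := (norm_nonneg _).trans hz
  rw [← Commute.geom_sum₂_mul (Commute.all z w), norm_mul, mul_right_comm, mul_comm]
  have hsum : ‖∑ i ∈ Finset.range n, z ^ i * w ^ (n - 1 - i)‖ ≤
      ∑ i ∈ Finset.range n, M ^ (n - 1) := by
    refine norm_sum_le_of_le _ fun i hi => ?_
    have hi' : i + (n - 1 - i) = n - 1 := by
      have := Finset.mem_range.1 hi
      lia
    rw [norm_mul, norm_pow, norm_pow, ← hi', pow_add, hi']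
    gcongr
  rw [Finset.sum_const, Finset.card_range, nsmul_eq_mul] at hsum
  calc ‖z - w‖ * ‖∑ i ∈ Finset.range n, z ^ i * w ^ (n - 1 - i)‖
      ≤ ‖z - w‖ * (n * M ^ (n - 1)) := by gcongr
    _ = n * M ^ (n - 1) * ‖z - w‖ := by ring

theorem integral_abs_pow_mul_exp_neg_mul_sq (j : ℕ) {a : ℝ} (ha : 0 < a) :
    ∫ s : ℝ, |s| ^ j * Real.exp (-(a * s ^ 2)) =
      a ^ (-((j : ℝ) + 1) / 2) * Real.Gamma (((j : ℝ) + 1) / 2) := by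
  have h := integral_rpow_mul_exp_neg_mul_rpow (p := 2) (q := j) two_pos
    (by have : (0 : ℝ) ≤ j := by positivity
        linarith) ha
  have h1 := integral_comp_abs (f := fun s : ℝ => s ^ j * Real.exp (-(a * s ^ 2)))
  simp only [sq_abs] at h1
  rw [h1]
  simp only [Real.rpow_natCast, Real.rpow_ofNat, neg_mul] at h
  rw [h]
  ring

theorem integrable_abs_pow_mul_exp_neg_mul_sq (j : ℕ) {a : ℝ} (ha : 0 < a) :
    Integrable fun s : ℝ => |s| ^ j * Real.exp (-(a * s ^ 2)) := by
  -- The Bochner integral of a non-integrable function is `0`, so the positive closed form already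
  -- proves integrability.
  refine Integrable.of_integral_ne_zero ?_
  rw [integral_abs_pow_mul_exp_neg_mul_sq j ha]
  have := Real.Gamma_pos_of_pos (s := ((j : ℝ) + 1) / 2) (by positivity)
  positivity

/-- The function `|s| exp (-c s² / 2)` restricted to `|s| > T`. -/
noncomputable def gaussianTail (c T s : ℝ) : ℝ :=
  (Set.Ioi T).indicator (fun u => u * Real.exp (-(c * u ^ 2 / 2))) |s|

theorem gaussianTail_nonneg (c T s : ℝ) : 0 ≤ gaussianTail c T s := by
  rw [gaussianTail, Set.indicator]
  split_ifs <;> positivity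

theorem integral_gaussianTail {c T : ℝ} (hc : 0 < c) (hT : 0 ≤ T) :
    ∫ s, gaussianTail c T s = 2 * (Real.exp (-(c * T ^ 2 / 2)) / c) := by
  unfold gaussianTail
  rw [integral_comp_abs (f := (Set.Ioi T).indicator fun u => u * Real.exp (-(c * u ^ 2 / 2))),
    setIntegral_indicator measurableSet_Ioi, Set.Ioi_inter_Ioi, max_eq_right hT]
  congr 1
  have hderiv : ∀ x ∈ Set.Ici T, HasDerivAt (fun u : ℝ => -(Real.exp (-(c * u ^ 2 / 2)) / c))
      (x * Real.exp (-(c * x ^ 2 / 2))) x := by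
    intro x _
    have h : HasDerivAt (fun u : ℝ => -(c * u ^ 2 / 2)) (-(c * x)) x := by
      refine ((((hasDerivAt_pow 2 x).const_mul c).div_const 2).neg).congr_deriv ?_
      simp
      ring
    refine ((h.exp.div_const c).neg).congr_deriv ?_
    field_simp
  have hlim : Tendsto (fun u : ℝ => -(Real.exp (-(c * u ^ 2 / 2)) / c)) atTop (𝓝 0) := by
    have h1 : Tendsto (fun u : ℝ => c * u ^ 2 / 2) atTop atTop :=
      ((tendsto_pow_atTop two_ne_zero).const_mul_atTop hc).atTop_div_const two_pos
    have h2 := ((Real.tendsto_exp_neg_atTop_nhds_zero.comp h1).div_const c).neg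
    simpa using h2
  rw [integral_Ioi_of_hasDerivAt_of_nonneg' hderiv (fun x hx => ?_) hlim]
  · ring
  · have : 0 ≤ x := hT.trans (le_of_lt hx)
    positivity

theorem integrable_gaussianTail {c T : ℝ} (hc : 0 < c) (hT : 0 ≤ T) :
    Integrable (gaussianTail c T) := by
  refine Integrable.of_integral_ne_zero ?_
  rw [integral_gaussianTail hc hT]
  positivity

end Elementary

/-! ### The estimate for centred laws of unit variance -/

section Normalized

theorem charFun_gaussianReal_zero_one (t : ℝ) :
    charFun (gaussianReal 0 1) t = ((Real.exp (-(t ^ 2 / 2)) : ℝ) : ℂ) := by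
  rw [charFun_gaussianReal]
  push_cast
  congr 1
  ring

variable {μ : Measure ℝ} {m n : ℕ} {a₁ a₂ ρ T : ℝ}

/-- With `3ρ ≤ exp (-t² / 2)` the error is at most `exp (-t² / 2) (exp (t² / 3) - 1)`; adding the
Gaussian term telescopes to `exp (-t² / 6)`. -/
theorem norm_charFun_le_exp_neg_sq_div_six (hm : 3 ≤ m)
    (hclose : ∀ t : ℝ, ‖charFun μ t - charFun (gaussianReal 0 1) t‖ ≤
      a₁ * (|t| ^ (m + 1) / (m + 1).factorial) + a₂ * (2 * (|t| ^ m / m.factorial)))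
    (ha₁ : a₁ ≤ ρ) (ha₂ : a₂ ≤ ρ) (hρ0 : 0 ≤ ρ) {t : ℝ}
    (hρ : 3 * ρ ≤ Real.exp (-(t ^ 2 / 2))) :
    ‖charFun μ t‖ ≤ Real.exp (-(t ^ 2 / 6)) := by
  have h1 := hclose t
  have h2 := pow_div_factorial_add_le hm (abs_nonneg t)
  rw [sq_abs] at h2
  have h3 : ‖charFun μ t - charFun (gaussianReal 0 1) t‖ ≤
      ρ * (3 * (Real.exp (t ^ 2 / 3) - 1)) := by
    refine h1.trans (le_trans ?_ (mul_le_mul_of_nonneg_left h2 hρ0))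
    rw [mul_add]
    gcongr
  have h4 : ρ * (3 * (Real.exp (t ^ 2 / 3) - 1)) ≤
      Real.exp (-(t ^ 2 / 2)) * (Real.exp (t ^ 2 / 3) - 1) := by
    have : 0 ≤ Real.exp (t ^ 2 / 3) - 1 := by
      linarith [Real.one_le_exp (show 0 ≤ t ^ 2 / 3 by positivity)]
    nlinarith
  have h5 : Real.exp (-(t ^ 2 / 2)) * Real.exp (t ^ 2 / 3) = Real.exp (-(t ^ 2 / 6)) := by
    rw [← Real.exp_add]
    congr 1
    ring
  have h6 : ‖charFun (gaussianReal 0 1) t‖ = Real.exp (-(t ^ 2 / 2)) := by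
    rw [charFun_gaussianReal_zero_one, Complex.norm_real, Real.norm_of_nonneg (Real.exp_nonneg _)]
  have h7 := norm_le_norm_add_norm_sub' (charFun μ t) (charFun (gaussianReal 0 1) t)
  rw [h6] at h7
  linarith

/-- The majorant of `‖g s ^ n - exp (-n s² / 2)‖ / |s|`, where `g` is the characteristic function
of `μ`. -/
noncomputable def charFunMajorant (μ : Measure ℝ) (m n : ℕ) (a₁ a₂ b T s : ℝ) : ℝ :=
  n * a₁ / (m + 1).factorial * (|s| ^ m * Real.exp (-(n / 12 * s ^ 2)))
    + n * (2 * a₂) / m.factorial * (|s| ^ (m - 1) * Real.exp (-(n / 12 * s ^ 2)))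
    + b ^ (n - 1) * ‖charFun μ s‖ + gaussianTail n T s

theorem charFunMajorant_nonneg (ha₁ : 0 ≤ a₁) (ha₂ : 0 ≤ a₂) {b : ℝ} (hb : 0 ≤ b) (s : ℝ) :
    0 ≤ charFunMajorant μ m n a₁ a₂ b T s := by
  have := gaussianTail_nonneg n T s
  unfold charFunMajorant
  positivity

theorem norm_charFun_pow_sub_le_charFunMajorant (hm : 3 ≤ m) (hn : 2 ≤ n)
    (hclose : ∀ t : ℝ, ‖charFun μ t - charFun (gaussianReal 0 1) t‖ ≤
      a₁ * (|t| ^ (m + 1) / (m + 1).factorial) + a₂ * (2 * (|t| ^ m / m.factorial)))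
    (ha₁ : 0 ≤ a₁) (ha₂ : 0 ≤ a₂) (ha₁ρ : a₁ ≤ ρ) (ha₂ρ : a₂ ≤ ρ)
    (hT : 1 ≤ T) (hρT : 3 * ρ ≤ Real.exp (-(T ^ 2 / 2))) {b : ℝ} (hb : 0 ≤ b)
    (hgb : ∀ s, 1 ≤ |s| → ‖charFun μ s‖ ≤ b) (s : ℝ) :
    ‖charFun μ s ^ n - charFun (gaussianReal 0 1) s ^ n‖ ≤
      |s| * charFunMajorant μ m n a₁ a₂ b T s := by
  have hρ0 : 0 ≤ ρ := ha₁.trans ha₁ρ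
  have htail := gaussianTail_nonneg n T s
  have hgauss : ‖charFun (gaussianReal 0 1) s‖ = Real.exp (-(s ^ 2 / 2)) := by
    rw [charFun_gaussianReal_zero_one, Complex.norm_real, Real.norm_of_nonneg (Real.exp_nonneg _)]
  rcases le_or_gt |s| T with h | h
  · have hsT : s ^ 2 ≤ T ^ 2 := by
      rw [← sq_abs]
      exact pow_le_pow_left₀ (abs_nonneg _) h 2
    have hg := norm_charFun_le_exp_neg_sq_div_six hm hclose ha₁ρ ha₂ρ hρ0 (t := s)
      (hρT.trans (Real.exp_le_exp.2 (by linarith)))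
    have hφ : ‖charFun (gaussianReal 0 1) s‖ ≤ Real.exp (-(s ^ 2 / 6)) := by
      rw [hgauss]
      exact Real.exp_le_exp.2 (by nlinarith [sq_nonneg s])
    -- Uses `n - 1 ≥ n / 2`, which is where `n ≥ 2` and the base `12` of `C1` come from.
    have hexp : Real.exp (-(s ^ 2 / 6)) ^ (n - 1) ≤ Real.exp (-(n / 12 * s ^ 2)) := by
      rw [← Real.exp_nat_mul, Nat.cast_sub (by lia)]
      refine Real.exp_le_exp.2 ?_
      have : (2 : ℝ) ≤ n := by exact_mod_cast hn
      push_cast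
      nlinarith [sq_nonneg s]
    have hms : |s| ^ m = |s| * |s| ^ (m - 1) := by
      rw [← pow_succ', Nat.sub_add_cancel (by lia)]
    have hrest : 0 ≤ |s| * (b ^ (n - 1) * ‖charFun μ s‖ + gaussianTail n T s) := by positivity
    calc ‖charFun μ s ^ n - charFun (gaussianReal 0 1) s ^ n‖
        ≤ n * ‖charFun μ s - charFun (gaussianReal 0 1) s‖
            * Real.exp (-(s ^ 2 / 6)) ^ (n - 1) := norm_pow_sub_pow_le hg hφ n
      _ ≤ n * (a₁ * (|s| ^ (m + 1) / (m + 1).factorial) + a₂ * (2 * (|s| ^ m / m.factorial)))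
            * Real.exp (-(n / 12 * s ^ 2)) := by
          gcongr
          exact hclose s
      _ = |s| * (n * a₁ / (m + 1).factorial * (|s| ^ m * Real.exp (-(n / 12 * s ^ 2)))
            + n * (2 * a₂) / m.factorial * (|s| ^ (m - 1) * Real.exp (-(n / 12 * s ^ 2)))) := by
          rw [pow_succ, hms]
          ring
      _ ≤ |s| * charFunMajorant μ m n a₁ a₂ b T s := by
          unfold charFunMajorant
          rw [mul_add] at hrest
          linear_combination hrest
  · have hs1 : 1 ≤ |s| := hT.trans h.le
    have htail' : gaussianTail n T s = |s| * Real.exp (-(n * s ^ 2 / 2)) := by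
      rw [gaussianTail, Set.indicator_of_mem (Set.mem_Ioi.2 h), sq_abs]
    have h1 : ‖charFun μ s‖ ^ n ≤ b ^ (n - 1) * ‖charFun μ s‖ := by
      conv_lhs => rw [← Nat.sub_add_cancel (by lia : 1 ≤ n), pow_succ]
      gcongr
      exact hgb s hs1
    have h2 : ‖charFun (gaussianReal 0 1) s‖ ^ n ≤ gaussianTail n T s := by
      rw [hgauss, ← Real.exp_nat_mul, htail']
      have : (n : ℝ) * -(s ^ 2 / 2) = -(n * s ^ 2 / 2) := by ring
      rw [this]
      exact le_mul_of_one_le_left (Real.exp_nonneg _) hs1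
    have h3 : b ^ (n - 1) * ‖charFun μ s‖ + gaussianTail n T s ≤
        charFunMajorant μ m n a₁ a₂ b T s := by
      unfold charFunMajorant
      have : 0 ≤ n * a₁ / (m + 1).factorial * (|s| ^ m * Real.exp (-(n / 12 * s ^ 2)))
        + n * (2 * a₂) / m.factorial * (|s| ^ (m - 1) * Real.exp (-(n / 12 * s ^ 2))) := by
        positivity
      linarith
    calc ‖charFun μ s ^ n - charFun (gaussianReal 0 1) s ^ n‖
        ≤ ‖charFun μ s‖ ^ n + ‖charFun (gaussianReal 0 1) s‖ ^ n := by
          rw [← norm_pow, ← norm_pow]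
          exact norm_sub_le _ _
      _ ≤ charFunMajorant μ m n a₁ a₂ b T s := (add_le_add h1 h2).trans h3
      _ ≤ |s| * charFunMajorant μ m n a₁ a₂ b T s :=
          le_mul_of_one_le_left (charFunMajorant_nonneg ha₁ ha₂ hb s) hs1

theorem integrable_charFunMajorant (hn : 2 ≤ n) (hT : 1 ≤ T)
    (hInt : Integrable (charFun μ)) (b : ℝ) :
    Integrable (charFunMajorant μ m n a₁ a₂ b T) := by
  have hn0 : (0 : ℝ) < n := by exact_mod_cast (by lia : 0 < n)
  unfold charFunMajorant
  exact ((((integrable_abs_pow_mul_exp_neg_mul_sq m (by positivity)).const_mul _).add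
    ((integrable_abs_pow_mul_exp_neg_mul_sq (m - 1) (by positivity)).const_mul _)).add
    (hInt.norm.const_mul _)).add (integrable_gaussianTail hn0 (by linarith))

/-- Used at `j = m`, and at `j = m - 1` with weight `2 a₂`, which is the factor `2` in `C2`. -/
theorem mul_integral_abs_pow_eq_C1 (hn : 2 ≤ n) (a : ℝ) (j : ℕ) :
    n * a / (j + 1).factorial * ∫ s : ℝ, |s| ^ j * Real.exp (-(n / 12 * s ^ 2)) =
      Real.pi * (Pseudomoments.C1 j * a / (n : ℝ) ^ (((j : ℝ) - 1) / 2)) := by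
  have hn0 : (0 : ℝ) < n := by exact_mod_cast (by lia : 0 < n)
  have hpi := Real.pi_pos
  have h1 : ((n : ℝ) / 12) ^ (-((j : ℝ) + 1) / 2) =
      (12 : ℝ) ^ (((j : ℝ) + 1) / 2) * ((n : ℝ) * (n : ℝ) ^ (((j : ℝ) - 1) / 2))⁻¹ := by
    have h2 : (n : ℝ) * (n : ℝ) ^ (((j : ℝ) - 1) / 2) = (n : ℝ) ^ (((j : ℝ) + 1) / 2) := by
      conv_lhs => rw [← Real.rpow_one_add' hn0.le (by
        have : (0 : ℝ) ≤ j := by positivity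
        linarith)]
      congr 1
      ring
    rw [h2, neg_div, Real.rpow_neg (by positivity), Real.div_rpow hn0.le (by norm_num), inv_div,
      div_eq_mul_inv]
  have hpow : (n : ℝ) ^ (((j : ℝ) - 1) / 2) ≠ 0 := (Real.rpow_pos_of_pos hn0 _).ne'
  rw [integral_abs_pow_mul_exp_neg_mul_sq j (by positivity), h1, Pseudomoments.C1]
  field_simp

theorem integral_charFunMajorant (hm : 3 ≤ m) (hn : 2 ≤ n) (hT : 1 ≤ T)
    (hInt : Integrable (charFun μ)) (b : ℝ) :
    ∫ s, charFunMajorant μ m n a₁ a₂ b T s =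
      Real.pi * (Pseudomoments.C1 m * a₁ / (n : ℝ) ^ (((m : ℝ) - 1) / 2))
      + Real.pi * (Pseudomoments.C2 m * a₂ / (n : ℝ) ^ (((m : ℝ) - 2) / 2))
      + b ^ (n - 1) * (∫ s, ‖charFun μ s‖)
      + 2 * (Real.exp (-(n * T ^ 2 / 2)) / n) := by
  have hn0 : (0 : ℝ) < n := by exact_mod_cast (by lia : 0 < n)
  have i1 := (integrable_abs_pow_mul_exp_neg_mul_sq m (a := (n : ℝ) / 12)
    (by positivity)).const_mul (n * a₁ / (m + 1).factorial)
  have i2 := (integrable_abs_pow_mul_exp_neg_mul_sq (m - 1) (a := (n : ℝ) / 12)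
    (by positivity)).const_mul (n * (2 * a₂) / m.factorial)
  have i3 := hInt.norm.const_mul (b ^ (n - 1))
  have i4 := integrable_gaussianTail hn0 (zero_le_one.trans hT)
  have e2 := mul_integral_abs_pow_eq_C1 hn (2 * a₂) (m - 1)
  rw [Nat.sub_add_cancel (by lia : 1 ≤ m), Nat.cast_sub (by lia : 1 ≤ m)] at e2
  unfold charFunMajorant
  rw [integral_add (by exact (i1.add i2).add i3) i4, integral_add (by exact i1.add i2) i3,
    integral_add i1 i2, integral_const_mul, integral_const_mul, integral_const_mul,
    integral_gaussianTail hn0 (zero_le_one.trans hT), mul_integral_abs_pow_eq_C1 hn, e2,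
    Pseudomoments.C2]
  have : ((m : ℝ) - (1 : ℕ) - 1) / 2 = ((m : ℝ) - 2) / 2 := by push_cast; ring
  rw [this]
  ring

end Normalized

/-! ### Distance to the normal distribution function -/

section NormalApproximation

/-- Normal approximation for a law `κ` whose characteristic function is `t ↦ g (t / √n) ^ n`, where
`g` is the characteristic function of a centred law `μ` of unit variance. -/
theorem abs_measureReal_Iio_sub_cdf_le {μ κ : Measure ℝ} [IsProbabilityMeasure μ]
    [IsProbabilityMeasure κ] {m n : ℕ} {a₁ a₂ ρ : ℝ} (hm : 3 ≤ m) (hn : 2 ≤ n)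
    (hInt : Integrable (charFun μ)) (hL2 : MemLp id 2 μ) (hmean : ∫ x, x ∂μ = 0)
    (hvar : ∫ x, x ^ 2 ∂μ = 1)
    (hclose : ∀ t : ℝ, ‖charFun μ t - charFun (gaussianReal 0 1) t‖ ≤
      a₁ * (|t| ^ (m + 1) / (m + 1).factorial) + a₂ * (2 * (|t| ^ m / m.factorial)))
    (hκ : ∀ t, charFun κ t = charFun μ (t / √n) ^ n)
    (ha₁ : 0 ≤ a₁) (ha₂ : 0 ≤ a₂) (ha₁ρ : a₁ ≤ ρ) (ha₂ρ : a₂ ≤ ρ) (hρ0 : 0 < ρ)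
    (hρ : ρ ≤ 1 / 2 * Real.exp (-(3 / 2))) (x : ℝ) :
    |κ.real (Set.Iio x) - cdf (gaussianReal 0 1) x| ≤
      Pseudomoments.C1 m * a₁ / (n : ℝ) ^ (((m : ℝ) - 1) / 2)
      + Pseudomoments.C2 m * a₂ / (n : ℝ) ^ (((m : ℝ) - 2) / 2)
      + (∫ s, ‖charFun μ s‖) / Real.pi * Pseudomoments.bConst (∫ s, ‖charFun μ s‖) 1 ^ (n - 1)
      + ρ * (4 * Real.exp (3 / 2) / Real.pi) * (Real.exp (-((n : ℝ) / 2)) / n) := by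
  set A := ∫ s, ‖charFun μ s‖ with hA
  set b := Pseudomoments.bConst A 1 with hb
  have hb0 : 0 ≤ b := Real.exp_nonneg _
  have hn0 : (0 : ℝ) < n := by exact_mod_cast (by lia : 0 < n)
  have hn2 : (2 : ℝ) ≤ n := by exact_mod_cast hn
  have hsn : 0 < √(n : ℝ) := Real.sqrt_pos.2 hn0
  have hpi := Real.pi_pos
  have he1 : (2 : ℝ) ≤ Real.exp 1 := by linarith [Real.add_one_le_exp (1 : ℝ)]
  have h3ρ : 3 * ρ ≤ Real.exp (-(1 / 2)) := by
    have : Real.exp (-(1 / 2)) = Real.exp 1 * Real.exp (-(3 / 2)) := by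
      rw [← Real.exp_add]
      norm_num
    rw [this]
    nlinarith [Real.exp_pos (-(3 / 2))]
  -- `T` is the largest radius on which the decay `exp (-s² / 6)` is guaranteed. The smallness of
  -- `ρ` gives `T ≥ 1`, so `|g| ≤ b` applies beyond it.
  obtain ⟨T, hT, hTρ⟩ : ∃ T : ℝ, 1 ≤ T ∧ Real.exp (-(T ^ 2 / 2)) = 3 * ρ := by
    have hlog : Real.log (3 * ρ) ≤ -(1 / 2) :=
      (Real.log_le_iff_le_exp (by positivity)).2 h3ρ
    refine ⟨√(-2 * Real.log (3 * ρ)), Real.one_le_sqrt.2 (by linarith), ?_⟩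
    rw [Real.sq_sqrt (by linarith)]
    have : -(-2 * Real.log (3 * ρ) / 2) = Real.log (3 * ρ) := by ring
    rw [this, Real.exp_log (by positivity)]
  have hgb : ∀ s, 1 ≤ |s| → ‖charFun μ s‖ ≤ b := fun s hs =>
    norm_charFun_le_bConst hInt hL2 hmean hvar hs
  have hmaj := norm_charFun_pow_sub_le_charFunMajorant hm hn hclose ha₁ ha₂ ha₁ρ ha₂ρ hT
    hTρ.ge hb0 hgb
  set D : ℝ → ℝ := charFunMajorant μ m n a₁ a₂ b T with hD
  have hDint : Integrable D := integrable_charFunMajorant hn hT hInt b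
  have hgn : ∀ t : ℝ, charFun (gaussianReal 0 1) t =
      charFun (gaussianReal 0 1) (t / √n) ^ n := by
    intro t
    rw [charFun_gaussianReal_zero_one, charFun_gaussianReal_zero_one, ← Complex.ofReal_pow,
      ← Real.exp_nat_mul, div_pow, Real.sq_sqrt hn0.le]
    congr 2
    field_simp
  have hκint : Integrable (charFun κ) := by
    refine (hInt.norm.comp_div hsn.ne').mono measurable_charFun.aestronglyMeasurable
      (.of_forall fun t => ?_)
    rw [hκ, norm_pow, norm_norm]
    exact pow_le_of_le_one (norm_nonneg _) (norm_charFun_le_one _) (by lia)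
  have hγ : (gaussianReal 0 1).real {x} = 0 := by
    have := nullSingletonClass_gaussianReal (μ := 0) (v := 1) one_ne_zero
    simp [measureReal_def]
  have hcdf : cdf (gaussianReal 0 1) x = (gaussianReal 0 1).real (Set.Iio x) := by
    have := nullSingletonClass_gaussianReal (μ := 0) (v := 1) one_ne_zero
    rw [cdf_eq_real, measureReal_def, measureReal_def, measure_congr Iio_ae_eq_Iic]
  have hbound := abs_measureReal_Iio_sub_le κ (gaussianReal 0 1)
    (D := fun t => (√(n : ℝ))⁻¹ * D (t / √n))
    (fun t => mul_nonneg (by positivity) (charFunMajorant_nonneg ha₁ ha₂ hb0 _))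
    ((hDint.comp_div hsn.ne').const_mul _)
    (fun t => by
      rw [hκ, hgn]
      refine (hmaj (t / √n)).trans (le_of_eq ?_)
      rw [abs_div, abs_of_pos hsn]
      ring)
    (measureReal_singleton_eq_zero_of_integrable_charFun κ hκint x) hγ
  have hscale : ∫ t, (√(n : ℝ))⁻¹ * D (t / √n) = ∫ s, D s := by
    rw [integral_const_mul, Measure.integral_comp_div, abs_of_pos hsn, smul_eq_mul,
      inv_mul_cancel_left₀ hsn.ne']
  rw [hcdf]
  refine hbound.trans ?_
  rw [hscale, hD, integral_charFunMajorant hm hn hT hInt b, ← hA]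
  have htail : 2 * (Real.exp (-(n * T ^ 2 / 2)) / n) / Real.pi ≤
      ρ * (4 * Real.exp (3 / 2) / Real.pi) * (Real.exp (-((n : ℝ) / 2)) / n) := by
    -- From `n T² ≥ T² + (n - 1)`: one factor `exp (-T² / 2)` becomes `3ρ`, the others are bounded
    -- using `T ≥ 1`.
    have h1 : Real.exp (-(n * T ^ 2 / 2)) ≤
        3 * ρ * (Real.exp (1 / 2) * Real.exp (-((n : ℝ) / 2))) := by
      rw [← hTρ, ← Real.exp_add, ← Real.exp_add]
      refine Real.exp_le_exp.2 ?_
      nlinarith [one_le_pow₀ hT (n := 2)]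
    have h2 : Real.exp (3 / 2) = Real.exp 1 * Real.exp (1 / 2) := by
      rw [← Real.exp_add]
      norm_num
    have h3 : 2 * Real.exp (-(n * T ^ 2 / 2)) ≤
        ρ * (4 * Real.exp (3 / 2)) * Real.exp (-((n : ℝ) / 2)) := by
      have h4 : 0 ≤ ρ * (Real.exp (1 / 2) * Real.exp (-((n : ℝ) / 2))) := by positivity
      rw [h2]
      nlinarith
    calc 2 * (Real.exp (-(n * T ^ 2 / 2)) / n) / Real.pi
        = 2 * Real.exp (-(n * T ^ 2 / 2)) / (n * Real.pi) := by field_simp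
      _ ≤ ρ * (4 * Real.exp (3 / 2)) * Real.exp (-((n : ℝ) / 2)) / (n * Real.pi) := by gcongr
      _ = _ := by field_simp
  rw [add_div, add_div, add_div, mul_div_cancel_left₀ _ hpi.ne', mul_div_cancel_left₀ _ hpi.ne']
  have : b ^ (n - 1) * A / Real.pi = A / Real.pi * b ^ (n - 1) := by ring
  rw [this]
  gcongr

end NormalApproximation

/-! ### Pseudomoments -/

namespace Pseudomoments

theorem C1_nonneg (m : ℕ) : 0 ≤ C1 m := by
  have := Real.Gamma_pos_of_pos (s := ((m : ℝ) + 1) / 2) (by positivity)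
  have := Real.pi_pos
  unfold C1
  positivity

theorem C2_nonneg (m : ℕ) : 0 ≤ C2 m := mul_nonneg two_pos.le (C1_nonneg _)

theorem nu1_nonneg (L : Measure ℝ) [IsFiniteMeasure L] (σ : ℝ) (m n : ℕ) : 0 ≤ nu1 L σ m n :=
  integral_nonneg fun _ => by positivity

theorem nu2_nonneg (L : Measure ℝ) [IsFiniteMeasure L] (σ : ℝ) (m n : ℕ) : 0 ≤ nu2 L σ m n :=
  integral_nonneg fun _ => by positivity

theorem bConst_lt_one {A σ : ℝ} (hA : 0 < A) (hσ : 0 < σ) : bConst A σ < 1 := by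
  have := Real.pi_pos
  rw [bConst, Real.exp_lt_one_iff, neg_lt_zero]
  positivity

/-- Scale invariance: rescaling to unit variance turns the `L¹` norm `A` into `σ A`. -/
theorem bConst_mul_one (A σ : ℝ) : bConst (σ * A) 1 = bConst A σ := by
  unfold bConst
  congr 4
  ring

theorem integrable_pow_gaussianReal (k : ℕ) :
    Integrable (fun x : ℝ => x ^ k) (gaussianReal 0 1) := by
  have h := (memLp_id_gaussianReal (μ := 0) (v := 1) k).integrable_norm_pow'
  refine h.mono (by fun_prop) (.of_forall fun x => ?_)
  simp

theorem integral_sq_gaussianReal : ∫ x, x ^ 2 ∂(gaussianReal 0 1) = 1 := by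
  have h := variance_fun_id_gaussianReal (μ := 0) (v := 1)
  rw [variance_of_integral_eq_zero (by fun_prop) integral_id_gaussianReal] at h
  simpa using h

/-- The law of `ξ / σ`, where `ξ` has law `L`. -/
noncomputable def scaledLaw (L : Measure ℝ) (σ : ℝ) : Measure ℝ := L.map fun x => x / σ

instance (L : Measure ℝ) [IsProbabilityMeasure L] (σ : ℝ) :
    IsProbabilityMeasure (scaledLaw L σ) :=
  Measure.isProbabilityMeasure_map (by fun_prop)

section ScaledLaw

variable {L : Measure ℝ} {σ : ℝ}

theorem charFun_scaledLaw (L : Measure ℝ) (σ t : ℝ) :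
    charFun (scaledLaw L σ) t = charFun L (t / σ) := by
  have h := charFun_map_mul (μ := L) σ⁻¹ t
  rw [div_eq_inv_mul, ← h, scaledLaw]
  simp_rw [div_eq_inv_mul]

theorem integral_norm_charFun_scaledLaw (L : Measure ℝ) (hσ : 0 < σ) :
    ∫ s, ‖charFun (scaledLaw L σ) s‖ = σ * charFunL1 L := by
  simp_rw [charFun_scaledLaw]
  rw [Measure.integral_comp_div (fun t => ‖charFun L t‖), abs_of_pos hσ, smul_eq_mul, charFunL1]

theorem integrable_charFun_scaledLaw (hσ : 0 < σ) (hL : Integrable (charFun L)) :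
    Integrable (charFun (scaledLaw L σ)) :=
  (hL.comp_div hσ.ne').congr (.of_forall fun t => (charFun_scaledLaw L σ t).symm)

theorem memLp_scaledLaw (hL2 : MemLp id 2 L) : MemLp id 2 (scaledLaw L σ) := by
  rw [scaledLaw, memLp_map_measure_iff (by fun_prop) (by fun_prop)]
  simpa [Function.comp_def, div_eq_inv_mul] using hL2.const_mul σ⁻¹

theorem integral_id_scaledLaw (hmean : ∫ x, x ∂L = 0) : ∫ x, x ∂(scaledLaw L σ) = 0 := by
  rw [scaledLaw, integral_map (by fun_prop) (by fun_prop), integral_div, hmean, zero_div]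

theorem integral_sq_scaledLaw (hσ : 0 < σ) (hvar : ∫ x, x ^ 2 ∂L = σ ^ 2) :
    ∫ x, x ^ 2 ∂(scaledLaw L σ) = 1 := by
  rw [scaledLaw, integral_map (by fun_prop) (by fun_prop)]
  simp_rw [div_pow]
  rw [integral_div, hvar, div_self (by positivity)]

variable [IsProbabilityMeasure L] {m : ℕ}

theorem pseudoMeasure_eq : pseudoMeasure L σ =
    (scaledLaw L σ).toSignedMeasure - (gaussianReal 0 1).toSignedMeasure := rfl

theorem integrable_pow_scaledLaw (hL2 : MemLp id 2 L)
    (hexists : ∀ k, 3 ≤ k → k ≤ m → (pseudoMeasure L σ).Integrable (fun x : ℝ => x ^ k))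
    (k : ℕ) (hk : k ≤ m) : Integrable (fun x : ℝ => x ^ k) (scaledLaw L σ) := by
  have h2 := memLp_scaledLaw (σ := σ) hL2
  rcases lt_or_ge k 3 with h | h
  · interval_cases k
    · simp
    · simp only [pow_one]
      exact h2.integrable one_le_two
    · exact h2.integrable_sq
  · exact (integrable_add_measure.2 ⟨hexists k h hk, integrable_pow_gaussianReal k⟩).mono_measure
      (le_variation_sub_add (scaledLaw L σ) (gaussianReal 0 1))

theorem integral_pow_scaledLaw (hσ : 0 < σ) (hL2 : MemLp id 2 L) (hmean : ∫ x, x ∂L = 0)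
    (hvar : ∫ x, x ^ 2 ∂L = σ ^ 2)
    (hexists : ∀ k, 3 ≤ k → k ≤ m → (pseudoMeasure L σ).Integrable (fun x : ℝ => x ^ k))
    (hzero : ∀ k, 3 ≤ k → k ≤ m → pseudomoment L σ k = 0) (k : ℕ) (hk : k ≤ m) :
    ∫ x, x ^ k ∂(scaledLaw L σ) = ∫ x, x ^ k ∂(gaussianReal 0 1) := by
  rcases lt_or_ge k 3 with h | h
  · interval_cases k
    · simp
    · simp only [pow_one]
      rw [integral_id_scaledLaw hmean, integral_id_gaussianReal]
    · rw [integral_sq_scaledLaw hσ hvar, integral_sq_gaussianReal]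
  · have h0 := hzero k h hk
    have h1 : (scaledLaw L σ).toSignedMeasure.Integrable (fun x : ℝ => x ^ k) := by
      simpa [VectorMeasure.Integrable] using integrable_pow_scaledLaw hL2 hexists k hk
    have h2 : (gaussianReal 0 1).toSignedMeasure.Integrable (fun x : ℝ => x ^ k) := by
      simpa [VectorMeasure.Integrable] using integrable_pow_gaussianReal k
    rw [pseudomoment, pseudoMeasure_eq, VectorMeasure.integral_sub_vectorMeasure h1 h2,
      VectorMeasure.integral_toSignedMeasure, VectorMeasure.integral_toSignedMeasure] at h0
    exact sub_eq_zero.1 h0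

theorem norm_charFun_scaledLaw_sub_le (hσ : 0 < σ) (hL2 : MemLp id 2 L)
    (hmean : ∫ x, x ∂L = 0) (hvar : ∫ x, x ^ 2 ∂L = σ ^ 2)
    (hexists : ∀ k, 3 ≤ k → k ≤ m → (pseudoMeasure L σ).Integrable (fun x : ℝ => x ^ k))
    (hzero : ∀ k, 3 ≤ k → k ≤ m → pseudomoment L σ k = 0) (n : ℕ) (t : ℝ) :
    ‖charFun (scaledLaw L σ) t - charFun (gaussianReal 0 1) t‖ ≤
      nu1 L σ m n * (|t| ^ (m + 1) / (m + 1).factorial)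
        + nu2 L σ m n * (2 * (|t| ^ m / m.factorial)) :=
  norm_charFun_sub_charFun_le (integrable_pow_scaledLaw hL2 hexists)
    (fun k _ => integrable_pow_gaussianReal k)
    (integral_pow_scaledLaw hσ hL2 hmean hvar hexists hzero) (σ * √n) t

end ScaledLaw

/-! ### Characteristic function of the normalized sum -/

section Sum

variable {Ω : Type*} [MeasurableSpace Ω] {P : Measure Ω} {ξ : ℕ → Ω → ℝ}

theorem sumCDF_eq_map (hmeas : ∀ i, Measurable (ξ i)) (σ : ℝ) (n : ℕ) (x : ℝ) :
    sumCDF P ξ σ n x =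
      (P.map fun ω => (σ * √(n : ℝ))⁻¹ * ∑ i ∈ Finset.range n, ξ i ω).real (Set.Iio x) := by
  rw [map_measureReal_apply (by fun_prop) measurableSet_Iio]
  rfl

theorem charFun_map_normalized_sum (hmeas : ∀ i, Measurable (ξ i)) (hindep : iIndepFun ξ P)
    (hident : ∀ i, IdentDistrib (ξ i) (ξ 0) P P) (σ : ℝ) (n : ℕ) (t : ℝ) :
    charFun (P.map fun ω => (σ * √(n : ℝ))⁻¹ * ∑ i ∈ Finset.range n, ξ i ω) t =
      charFun (scaledLaw (P.map (ξ 0)) σ) (t / √n) ^ n := by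
  have h := charFun_inv_sqrt_mul_sum hindep hident (n := n) (t := t / σ)
  rw [charFun_map_mul_comp (by fun_prop)] at h
  rw [charFun_map_mul_comp (by fun_prop), charFun_scaledLaw]
  have e1 : (σ * √(n : ℝ))⁻¹ * t = (√(n : ℝ))⁻¹ * (t / σ) := by
    rw [mul_inv]
    ring
  have e2 : t / √(n : ℝ) / σ = (√(n : ℝ))⁻¹ * (t / σ) := by ring
  rw [e1, e2, h]

end Sum

end Pseudomoments

theorem theorem1 {Ω : Type*} [MeasurableSpace Ω] (P : Measure Ω) [IsProbabilityMeasure P]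
    (ξ : ℕ → Ω → ℝ) (hmeas : ∀ i, Measurable (ξ i)) (hindep : iIndepFun ξ P)
    (hident : ∀ i, IdentDistrib (ξ i) (ξ 0) P P)
    (hL2 : MemLp (ξ 0) 2 P) (hmean : ∫ ω, ξ 0 ω ∂P = 0)
    (σ : ℝ) (hσ : 0 < σ) (hvar : variance (ξ 0) P = σ ^ 2)
    -- (i) integrability of the characteristic function
    (hchar : Integrable (fun t : ℝ => charFun (P.map (ξ 0)) t))
    -- (ii) the pseudomoments of orders `3, …, m` exist and vanish
    (m : ℕ) (hm : 3 ≤ m)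
    (hexists : ∀ k, 3 ≤ k → k ≤ m →
      (Pseudomoments.pseudoMeasure (P.map (ξ 0)) σ).Integrable (fun x : ℝ => x ^ k))
    (hzero : ∀ k, 3 ≤ k → k ≤ m → Pseudomoments.pseudomoment (P.map (ξ 0)) σ k = 0) :
    Pseudomoments.bConst (Pseudomoments.charFunL1 (P.map (ξ 0))) σ < 1 ∧
    ∀ n : ℕ, 2 ≤ n →
      Pseudomoments.nu (P.map (ξ 0)) σ m n < 1 / 2 * Real.exp (-(3 / 2)) →
      (⨆ x : ℝ, |Pseudomoments.sumCDF P ξ σ n x - Pseudomoments.stdNormalCDF x|) ≤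
        2 * Pseudomoments.C1 m * Pseudomoments.nu1 (P.map (ξ 0)) σ m n
            / (n : ℝ) ^ (((m : ℝ) - 1) / 2)
        + 2 * Pseudomoments.C2 m * Pseudomoments.nu2 (P.map (ξ 0)) σ m n
            / (n : ℝ) ^ (((m : ℝ) - 2) / 2)
        + σ * Pseudomoments.charFunL1 (P.map (ξ 0)) / Real.pi
            * Pseudomoments.bConst (Pseudomoments.charFunL1 (P.map (ξ 0))) σ ^ (n - 1)
        + Pseudomoments.nu (P.map (ξ 0)) σ m n * (4 * Real.exp (3 / 2) / Real.pi)
            * (Real.exp (-((n : ℝ) / 2)) / (n : ℝ)) := by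
  open Pseudomoments in
  have hξ : Measurable (ξ 0) := hmeas 0
  set L := P.map (ξ 0) with hL
  have hLprob : IsProbabilityMeasure L := Measure.isProbabilityMeasure_map hξ.aemeasurable
  have hL2' : MemLp id 2 L := (memLp_map_measure_iff (by fun_prop) hξ.aemeasurable).2 hL2
  have hmean' : ∫ x, x ∂L = 0 := by
    rw [hL, integral_map hξ.aemeasurable (by fun_prop), hmean]
  have hvar' : ∫ x, x ^ 2 ∂L = σ ^ 2 := by
    rw [hL, integral_map hξ.aemeasurable (by fun_prop), ← hvar,
      variance_of_integral_eq_zero hξ.aemeasurable hmean]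
  have hInt := integrable_charFun_scaledLaw hσ hchar
  have hμ2 := memLp_scaledLaw (σ := σ) hL2'
  have hμmean := integral_id_scaledLaw (σ := σ) hmean'
  have hμvar := integral_sq_scaledLaw hσ hvar'
  have hA := integral_norm_charFun_scaledLaw L hσ
  have hApos : 0 < charFunL1 L := by
    -- The single interval around `0` (`K = 0`) already gives `σ A ≥ 12/25`.
    have h := le_integral_norm_charFun hInt hμ2 hμmean hμvar le_rfl 0 (by norm_num)
    rw [hA] at h
    norm_num at h
    exact pos_of_mul_pos_right (by linarith : 0 < σ * charFunL1 L) hσ.le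
  refine ⟨bConst_lt_one hApos hσ, fun n hn hν => ciSup_le fun x => ?_⟩
  set κ := P.map fun ω => (σ * √(n : ℝ))⁻¹ * ∑ i ∈ Finset.range n, ξ i ω with hκ
  have hκprob : IsProbabilityMeasure κ :=
    Measure.isProbabilityMeasure_map (by fun_prop)
  have hn0 : (0 : ℝ) < n := by exact_mod_cast (by lia : 0 < n)
  have hν1 := nu1_nonneg L σ m n
  have hν2 := nu2_nonneg L σ m n
  have hν0 : 0 ≤ nu L σ m n := le_max_of_le_left hν1
  rw [sumCDF_eq_map hmeas, ← hκ, stdNormalCDF]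
  have hbound : ∀ ρ : ℝ, nu L σ m n < ρ → ρ ≤ 1 / 2 * Real.exp (-(3 / 2)) → _ :=
    fun ρ hρν hρ => abs_measureReal_Iio_sub_cdf_le (κ := κ) hm hn hInt hμ2 hμmean hμvar
      (norm_charFun_scaledLaw_sub_le hσ hL2' hmean' hvar' hexists hzero n)
      (charFun_map_normalized_sum hmeas hindep hident σ n) hν1 hν2
      ((le_max_left _ _).trans hρν.le) ((le_max_right _ _).trans hρν.le) (hν0.trans_lt hρν) hρ x
  rw [hA, bConst_mul_one] at hbound
  -- Defining `T` needs `ρ > 0`, but `ν_n(m)` may be `0`; so the bound is taken for `ρ` above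
  -- `ν_n(m)` and `ρ` decreases to it.
  have hlim : |κ.real (Set.Iio x) - cdf (gaussianReal 0 1) x| ≤
      C1 m * nu1 L σ m n / (n : ℝ) ^ (((m : ℝ) - 1) / 2)
      + C2 m * nu2 L σ m n / (n : ℝ) ^ (((m : ℝ) - 2) / 2)
      + σ * charFunL1 L / Real.pi * bConst (charFunL1 L) σ ^ (n - 1)
      + nu L σ m n * (4 * Real.exp (3 / 2) / Real.pi) * (Real.exp (-((n : ℝ) / 2)) / n) := by
    refine ge_of_tendsto (x := nhdsWithin (nu L σ m n) (Set.Ioi (nu L σ m n))) (f := fun ρ : ℝ =>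
      C1 m * nu1 L σ m n / (n : ℝ) ^ (((m : ℝ) - 1) / 2)
      + C2 m * nu2 L σ m n / (n : ℝ) ^ (((m : ℝ) - 2) / 2)
      + σ * charFunL1 L / Real.pi * bConst (charFunL1 L) σ ^ (n - 1)
      + ρ * (4 * Real.exp (3 / 2) / Real.pi) * (Real.exp (-((n : ℝ) / 2)) / n)) ?_ ?_
    · exact tendsto_nhdsWithin_of_tendsto_nhds (Continuous.tendsto (by fun_prop) _)
    · filter_upwards [Ioo_mem_nhdsGT hν] with ρ hρ
      exact hbound ρ hρ.1 hρ.2.le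
  -- The estimate just obtained lacks the factors `2` in the first two terms; nonnegativity is all
  -- that is needed to insert them.
  have h1 : 0 ≤ C1 m * nu1 L σ m n / (n : ℝ) ^ (((m : ℝ) - 1) / 2) := by
    have := C1_nonneg m
    positivity
  have h2 : 0 ≤ C2 m * nu2 L σ m n / (n : ℝ) ^ (((m : ℝ) - 2) / 2) := by
    have := C2_nonneg m
    positivity
  have e1 : 2 * C1 m * nu1 L σ m n / (n : ℝ) ^ (((m : ℝ) - 1) / 2) =
      2 * (C1 m * nu1 L σ m n / (n : ℝ) ^ (((m : ℝ) - 1) / 2)) := by ring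
  have e2 : 2 * C2 m * nu2 L σ m n / (n : ℝ) ^ (((m : ℝ) - 2) / 2) =
      2 * (C2 m * nu2 L σ m n / (n : ℝ) ^ (((m : ℝ) - 2) / 2)) := by ring
  rw [e1, e2]
  linarith
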